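/- Let $n\ge 2$ and $0<H<\frac{n-1}{n}$. Let $\mathbb H^n=\{x\in\mathbb R^n:|x|<1\}$ carry the metric $4(1-|x|^2)^{-2}|dx|^2$ and $\mathbb H^n\times\mathbb R$ the product metric. Let $e\in\mathbb R^n$ be a unit vector and let $\mathbb P=\{x\in\mathbb H^n:\langle x,e\rangle=0\}$ be the totally geodesic hyperplane orthogonal at $0$ to the geodesic $\rho\mapsto\tanh(\rho/2)\,e$. The translation hypersurface generated by a curve $\rho\mapsto(\tanh(\rho/2)\,e,\mu(\rho))$ is the union of the images of this curve under the isometries $\tau\times\mathrm{id}_{\mathbb R}$, where $\tau$ runs over the hyperbolic translations along the geodesics of $\mathbb P$ through $0$. The mean curvature of a hypersurface is the normalized trace of its second fundamental form. Then there are $r>0$, a smooth strictly increasing function $\mu:(r,\infty)\to\mathbb R$ and the translation hypersurface $\mathcal T_H$ generated by $\rho\mapsto(\tanh(\rho/2)\,e,\mu(\rho))$, $\rho>r$, with the following properties. Let $\Gamma\subset\mathbb H^n$ be the equidistant hypersurface at distance $r$ from $\mathbb P$ on the side of $e$. 1. $\Gamma$ has constant mean curvature $\frac{nH}{n-1}$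 with respect to one of its unit normal fields $\nu$. The set $\mathbb H^n\setminus\Gamma$ has exactly two connected components, the mean convex side of $\Gamma$, into which $\nu$ points, and the non-mean-convex side $\Omega$. 2. $\mathcal T_H$ is a smooth embedded hypersurface of $\mathbb H^n\times\mathbb R$, complete for the induced Riemannian metric, with constant mean curvature $H$ with respect to the unit normal pointing upwards. It is the vertical graph of a smooth function $u:\Omega\to\mathbb R$. 3. $\mathcal T_H$ takes infinite boundary value data on $\Gamma$ and infinite asymptotic boundary data: $u(x)\to-\infty$ as $x\in\Omega$ tends to any point of $\Gamma$, and $u(x)\to+\infty$ as $x\in\Omega$ tends to any point $\xi$ of the asymptotic boundary of $\Omega$ that is not in the asymptotic boundary of $\Gamma$ (that is, $|\xi|=1$ and $\xi\in\overline\Omega\setminus\overline\Gamma$, with closures taken in $\mathbb R^n$). -/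

import Mathlib

open Set Filter Topology
open scoped ContDiff

noncomputable section

namespace HypProd

/-! ### Riemannian geometry in a global chart

A Riemannian metric on an open subset of a finite-dimensional real vector space `E` is written as a
function `g : E → E → E → ℝ`, where `g p v w` is the inner product at `p` of the vectors
`v` and `w`. -/

section Riemannian

variable {E : Type*} [NormedAddCommGroup E] [NormedSpace ℝ E]

/-- `covInner g p v X z` is `g (∇_v X, z)` at the point `p`, where `∇` is the Levi-Civita connection
of `g`, written out with the Christoffel symbols of the first kind. -/
def covInner (g : E → E → E → ℝ) (p v : E) (X : E → E) (z : E) : ℝ :=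
  g p (fderiv ℝ X p v) z
    + (1 / 2) * (fderiv ℝ (fun y => g y (X p) z) p v
        + fderiv ℝ (fun y => g y v z) p (X p)
        - fderiv ℝ (fun y => g y v (X p)) p z)

/-- `F` is a smooth local equation of the set `S` near `p` with non-zero differential at `p`.
If `p ∈ S`, the set `S` is then near `p` an embedded smooth hypersurface whose tangent space at `p`
is the kernel of `fderiv ℝ F p`. -/
def IsLocalEquation (S : Set E) (F : E → ℝ) (p : E) : Prop :=
  fderiv ℝ F p ≠ 0 ∧
    ∃ U ∈ 𝓝 p, ContDiffOn ℝ ∞ F U ∧ ∀ x ∈ U, (x ∈ S ↔ F x = 0)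

/-- `S` is an embedded smooth hypersurface, `N` is a smooth field of unit normals along `S` (given
on some open neighbourhood of `S`), and `S` has constant mean curvature `h` with respect to `N`.

The mean curvature is the normalized trace `(1 / m) ∑ i, II (e i, e i)`, where `m = dim S`, `e` is an
orthonormal basis of the tangent space, and `II (v, w) = - g (∇_v N, w)`. -/
def HasConstMeanCurvature (g : E → E → E → ℝ) (S : Set E) (N : E → E) (h : ℝ) : Prop :=
  (∃ V, IsOpen V ∧ S ⊆ V ∧ ContDiffOn ℝ ∞ N V) ∧
  ∀ p ∈ S, ∃ F : E → ℝ, IsLocalEquation S F p ∧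
    g p (N p) (N p) = 1 ∧
    (∀ v, fderiv ℝ F p v = 0 → g p (N p) v = 0) ∧
    ∀ (m : ℕ) (e : Fin m → E), m + 1 = Module.finrank ℝ E →
      (∀ i, fderiv ℝ F p (e i) = 0) →
      (∀ i j, g p (e i) (e j) = if i = j then 1 else 0) →
      (1 / (m : ℝ)) * ∑ i, -covInner g p (e i) N (e i) = h

/-- The length, for the metric `g`, of the restriction to `[0, 1]` of a curve. -/
def curveLength (g : E → E → E → ℝ) (c : ℝ → E) : ℝ :=
  ∫ s in (0 : ℝ)..1, Real.sqrt (g (c s) (deriv c s) (deriv c s))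

/-- The intrinsic Riemannian distance of `S`: the infimum of the lengths of the `C¹` curves in `S`
from `x` to `y` (it is `⊤` if there is no such curve). -/
def intrinsicEDist (g : E → E → E → ℝ) (S : Set E) (x y : E) : ENNReal :=
  ⨅ (c : ℝ → E) (_ : ContDiff ℝ 1 c ∧ c 0 = x ∧ c 1 = y ∧ ∀ s ∈ Icc (0 : ℝ) 1, c s ∈ S),
    ENNReal.ofReal (curveLength g c)

/-- `S`, with the Riemannian metric induced by `g`, is complete: every Cauchy sequence for the
intrinsic distance converges in `S`. -/
def IsRiemannianComplete (g : E → E → E → ℝ) (S : Set E) : Prop :=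
  ∀ x : ℕ → E, (∀ k, x k ∈ S) →
    (∀ ε : ENNReal, 0 < ε → ∃ K, ∀ i ≥ K, ∀ j ≥ K, intrinsicEDist g S (x i) (x j) < ε) →
    ∃ y ∈ S, Tendsto (fun k => intrinsicEDist g S (x k) y) atTop (𝓝 0)

/-- `D` is a connected component of the set `A`. -/
def IsComponent (A D : Set E) : Prop :=
  ∃ x ∈ A, D = connectedComponentIn A x

/-- The vectors `N p`, `p ∈ S`, point into `D`. -/
def PointsInto (S : Set E) (N : E → E) (D : Set E) : Prop :=
  ∀ p ∈ S, ∀ᶠ s in 𝓝[>] (0 : ℝ), p + s • N p ∈ D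

end Riemannian

/-! ### Hyperbolic space and its product with the line -/

section Hyperbolic

variable {n : ℕ}

/-- The ball model of hyperbolic space, as a set. -/
def ball (n : ℕ) : Set (EuclideanSpace ℝ (Fin n)) := {x | ‖x‖ < 1}

/-- The hyperbolic metric `4 (1 - |x|²)⁻² (dx₁² + ⋯ + dxₙ²)` on the ball. -/
def hypMetric (n : ℕ) (x v w : EuclideanSpace ℝ (Fin n)) : ℝ :=
  4 / (1 - ‖x‖ ^ 2) ^ 2 * inner ℝ v w

/-- The product metric on (ball) `× ℝ`. -/
def prodMetric (n : ℕ) (p v w : EuclideanSpace ℝ (Fin n) × ℝ) : ℝ :=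
  hypMetric n p.1 v.1 w.1 + v.2 * w.2

/-- The totally geodesic hyperplane through `0` orthogonal to the geodesic
`ρ ↦ tanh (ρ / 2) • e` (for a unit vector `e`). -/
def hyperplane (e : EuclideanSpace ℝ (Fin n)) : Set (EuclideanSpace ℝ (Fin n)) :=
  {x | x ∈ ball n ∧ inner ℝ x e = 0}

/-- The equidistant hypersurface at hyperbolic distance `r` from `hyperplane e`, on the side of
`e`. -/
def equidistant (e : EuclideanSpace ℝ (Fin n)) (r : ℝ) : Set (EuclideanSpace ℝ (Fin n)) :=
  {x | x ∈ ball n ∧ 0 < inner ℝ x e ∧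
    ⨅ y ∈ hyperplane e, intrinsicEDist (hypMetric n) (ball n) x y = ENNReal.ofReal r}

/-- For `a` in the ball, the hyperbolic translation along the geodesic through `0` and `a` that
carries `0` to `a` (Möbius addition `a ⊕ x`); it is the identity for `a = 0`. -/
def hypTranslation (a x : EuclideanSpace ℝ (Fin n)) : EuclideanSpace ℝ (Fin n) :=
  (1 + 2 * inner ℝ a x + ‖a‖ ^ 2 * ‖x‖ ^ 2)⁻¹ •
    ((1 + 2 * inner ℝ a x + ‖x‖ ^ 2) • a + (1 - ‖a‖ ^ 2) • x)

/-- The translation hypersurface generated by the curve `ρ ↦ (tanh (ρ / 2) • e, μ ρ)`, `ρ ∈ I`, of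
the vertical plane over the geodesic in the direction `e`: the union of the images of the curve
under the translations, acting slice-wise, along the geodesics through `0` in `hyperplane e`. -/
def translationHypersurface (e : EuclideanSpace ℝ (Fin n)) (I : Set ℝ) (μ : ℝ → ℝ) :
    Set (EuclideanSpace ℝ (Fin n) × ℝ) :=
  {q | ∃ a ∈ hyperplane e, ∃ ρ ∈ I, q = (hypTranslation a (Real.tanh (ρ / 2) • e), μ ρ)}

/-- `Γ` separates hyperbolic space into exactly two components, the unit normal field `N` points
into one of them, and `Ω` is the other one. If `Γ` has positive mean curvature with respect to `N`,
then `Ω` is the non-mean-convex side of `Γ`. -/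
def IsSideOppositeTo (Γ : Set (EuclideanSpace ℝ (Fin n)))
    (N : EuclideanSpace ℝ (Fin n) → EuclideanSpace ℝ (Fin n))
    (Ω : Set (EuclideanSpace ℝ (Fin n))) : Prop :=
  ∃ D, IsComponent (ball n \ Γ) D ∧ IsComponent (ball n \ Γ) Ω ∧ D ≠ Ω ∧ D ∪ Ω = ball n \ Γ ∧
    PointsInto Γ N D

/-- `M` is the vertical graph of the smooth function `u` over `Ω`. -/
def IsVerticalGraph (M : Set (EuclideanSpace ℝ (Fin n) × ℝ))
    (Ω : Set (EuclideanSpace ℝ (Fin n))) (u : EuclideanSpace ℝ (Fin n) → ℝ) : Prop :=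
  ContDiffOn ℝ ∞ u Ω ∧ M = {q | q.1 ∈ Ω ∧ q.2 = u q.1}

end Hyperbolic

end HypProd

end

open Set Filter Topology
open scoped ContDiff

noncomputable section

namespace HypProd

variable {n : ℕ}

/-! Put k = n - 1 and let d be the signed distance to the hyperplane. The geodesics orthogonal to
the hyperplane fill the ball, and translations along the hyperplane permute them and preserve d.
Hence the translation hypersurface is the graph of u = μ ∘ d over {d > r}, and Γ = {d = r}.

Curvature rests on one vector field, the gradient Y of sinh d: it satisfies |Y| = cosh d and ∇_v Y =
(sinh d) v (`hypMetric_conformalField_self`, `covInner_smul_conformalField`). So -Y / cosh d is a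
unit normal of Γ with all principal curvatures equal to tanh r. The choice tanh r = nH/(n-1) is
possible because H < (n-1)/n.

Let φ = μ' / √(1 + μ'²). The upward normal of the graph is (-φ ∇d, √(1 - φ²)), and the mean
curvature equation nH = div(φ ∇d) becomes the linear equation φ' + k tanh ρ φ = k tanh r. `profile`
is the solution with φ(r) = 1, for which the generating curve becomes vertical at Γ. For ρ > r one
has tanh r ≤ φ < 1, so μ' = φ / √(1 - φ²) is smooth and at least tanh r, and μ tends to +∞ at
infinity. The equation also forces φ'(r) = 0, so 1 - φ = O((ρ - r)²) and μ' ≥ c / (ρ - r): the slope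
is not integrable at r (hence the base point r + 1 in `height`), and μ tends to -∞ there.

For completeness, a sequence that is Cauchy for the intrinsic distance is Cauchy in the ambient
norm. Its limit stays over the ball because log (1 - |x|²) is 1-Lipschitz, and stays off Γ because u
tends to -∞ there while the heights converge. Near an interior point of a smooth graph, intrinsic
distance is controlled by the Euclidean distance of the projections. -/

/-! ### The signed distance to the hyperplane and its gradient -/

/-- The hyperbolic sine of the signed hyperbolic distance from `x` to `hyperplane e`. -/
def sinhDist (e x : EuclideanSpace ℝ (Fin n)) : ℝ := 2 * inner ℝ x e / (1 - ‖x‖ ^ 2)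

/-- The signed hyperbolic distance from `x` to `hyperplane e`. -/
def hyperplaneDist (e x : EuclideanSpace ℝ (Fin n)) : ℝ := Real.arsinh (sinhDist e x)

/-- The hyperbolic gradient of `sinhDist e`, a conformal vector field. -/
def conformalField (e x : EuclideanSpace ℝ (Fin n)) : EuclideanSpace ℝ (Fin n) :=
  ((1 - ‖x‖ ^ 2) / 2) • e + inner ℝ x e • x

theorem one_sub_norm_sq_pos {x : EuclideanSpace ℝ (Fin n)} (hx : x ∈ ball n) :
    0 < 1 - ‖x‖ ^ 2 := by
  have h : ‖x‖ < 1 := hx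
  nlinarith [norm_nonneg x]

theorem isOpen_ball : IsOpen (ball n) := isOpen_lt continuous_norm continuous_const

theorem hypMetric_comm (x v w : EuclideanSpace ℝ (Fin n)) :
    hypMetric n x v w = hypMetric n x w v := by
  simp only [hypMetric, real_inner_comm]

theorem hypMetric_self (x v : EuclideanSpace ℝ (Fin n)) :
    hypMetric n x v v = (2 * ‖v‖ / (1 - ‖x‖ ^ 2)) ^ 2 := by
  rw [hypMetric, real_inner_self_eq_norm_sq, div_pow, mul_pow]; ring

theorem hasFDerivAt_one_sub_norm_sq (x : EuclideanSpace ℝ (Fin n)) :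
    HasFDerivAt (fun y : EuclideanSpace ℝ (Fin n) => 1 - ‖y‖ ^ 2) (-(2 • innerSL ℝ x)) x :=
  (hasStrictFDerivAt_norm_sq x).hasFDerivAt.const_sub 1

theorem hasFDerivAt_sinhDist (e : EuclideanSpace ℝ (Fin n)) {x : EuclideanSpace ℝ (Fin n)}
    (hx : x ∈ ball n) :
    HasFDerivAt (sinhDist e) ((4 / (1 - ‖x‖ ^ 2) ^ 2) • innerSL ℝ (conformalField e x)) x := by
  have h0 := (one_sub_norm_sq_pos hx).ne'
  have h1 : HasFDerivAt (fun y : EuclideanSpace ℝ (Fin n) => 2 * inner ℝ y e)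
      ((2 : ℝ) • innerSL ℝ e) x := by
    have := ((innerSL ℝ e).hasFDerivAt (x := x)).const_mul 2
    refine this.congr_of_eventuallyEq (Eventually.of_forall fun y => ?_)
    simp [real_inner_comm]
  have h2 := (hasDerivAt_inv h0).comp_hasFDerivAt x (hasFDerivAt_one_sub_norm_sq x)
  have h3 : HasFDerivAt (sinhDist e) _ x :=
    (h1.mul h2).congr_of_eventuallyEq (Eventually.of_forall fun y => div_eq_mul_inv _ _)
  refine h3.congr_fderiv ?_
  ext v
  simp only [Function.comp_apply, conformalField, smul_apply, add_apply, neg_apply,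
    innerSL_apply_apply, smul_eq_mul, map_add, map_smul, nsmul_eq_mul]
  field_simp
  push_cast
  ring

theorem contDiffOn_sinhDist (e : EuclideanSpace ℝ (Fin n)) : ContDiffOn ℝ ∞ (sinhDist e) (ball n) := by
  refine ContDiffOn.div ?_ ?_ fun x hx => (one_sub_norm_sq_pos hx).ne'
  · exact (contDiff_const.mul (contDiff_id.inner ℝ contDiff_const)).contDiffOn
  · exact (contDiff_const.sub (contDiff_norm_sq ℝ)).contDiffOn

theorem contDiffOn_hyperplaneDist (e : EuclideanSpace ℝ (Fin n)) :
    ContDiffOn ℝ ∞ (hyperplaneDist e) (ball n) :=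
  Real.contDiff_arsinh.comp_contDiffOn (contDiffOn_sinhDist e)

theorem contDiff_conformalField (e : EuclideanSpace ℝ (Fin n)) :
    ContDiff ℝ ∞ (conformalField e) := by
  refine ContDiff.add ?_ ?_
  · exact ((contDiff_const.sub (contDiff_norm_sq ℝ)).div_const 2).smul contDiff_const
  · exact (contDiff_id.inner ℝ contDiff_const).smul contDiff_id

theorem hypMetric_conformalField_self {e : EuclideanSpace ℝ (Fin n)} (he : ‖e‖ = 1)
    {x : EuclideanSpace ℝ (Fin n)} (hx : x ∈ ball n) :
    hypMetric n x (conformalField e x) (conformalField e x) = 1 + sinhDist e x ^ 2 := by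
  have h0 := (one_sub_norm_sq_pos hx).ne'
  have hee : inner ℝ e e = (1 : ℝ) := by rw [real_inner_self_eq_norm_sq, he, one_pow]
  simp only [hypMetric, conformalField, sinhDist, inner_add_left, inner_add_right,
    real_inner_smul_left, real_inner_smul_right, hee, real_inner_self_eq_norm_sq x,
    real_inner_comm x e]
  field_simp
  ring

theorem hasFDerivAt_hyperplaneDist (e : EuclideanSpace ℝ (Fin n)) {x : EuclideanSpace ℝ (Fin n)}
    (hx : x ∈ ball n) :
    HasFDerivAt (hyperplaneDist e)
      ((Real.cosh (hyperplaneDist e x))⁻¹ •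
        ((4 / (1 - ‖x‖ ^ 2) ^ 2) • innerSL ℝ (conformalField e x))) x := by
  have := (hasFDerivAt_sinhDist e hx).arsinh
  rwa [← Real.cosh_arsinh] at this

theorem sinh_hyperplaneDist (e x : EuclideanSpace ℝ (Fin n)) :
    Real.sinh (hyperplaneDist e x) = sinhDist e x := Real.sinh_arsinh _

theorem hypMetric_conformalField_self_eq_cosh {e : EuclideanSpace ℝ (Fin n)} (he : ‖e‖ = 1)
    {x : EuclideanSpace ℝ (Fin n)} (hx : x ∈ ball n) :
    hypMetric n x (conformalField e x) (conformalField e x) = Real.cosh (hyperplaneDist e x) ^ 2 := by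
  rw [hypMetric_conformalField_self he hx, Real.cosh_sq, sinh_hyperplaneDist, add_comm]

theorem hypMetric_sq_le (x v w : EuclideanSpace ℝ (Fin n)) :
    hypMetric n x v w ^ 2 ≤ hypMetric n x v v * hypMetric n x w w := by
  have := real_inner_mul_inner_self_le v w
  simp only [hypMetric]
  have h : 0 ≤ (4 / (1 - ‖x‖ ^ 2) ^ 2) ^ 2 := by positivity
  nlinarith [mul_le_mul_of_nonneg_left this h]

/-- The gradient of the distance is Y / cosh d, a unit vector, so this is Cauchy–Schwarz. It gives
the lower bound for the distance to the hyperplane. -/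
theorem norm_fderiv_hyperplaneDist_le {e : EuclideanSpace ℝ (Fin n)} (he : ‖e‖ = 1)
    {x : EuclideanSpace ℝ (Fin n)} (hx : x ∈ ball n) (v : EuclideanSpace ℝ (Fin n)) :
    ‖fderiv ℝ (hyperplaneDist e) x v‖ ≤ Real.sqrt (hypMetric n x v v) := by
  have hc := Real.cosh_pos (hyperplaneDist e x)
  rw [(hasFDerivAt_hyperplaneDist e hx).fderiv, Real.norm_eq_abs]
  apply Real.abs_le_sqrt
  have h := hypMetric_sq_le x (conformalField e x) v
  rw [hypMetric_conformalField_self_eq_cosh he hx] at h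
  have h2 : ((Real.cosh (hyperplaneDist e x))⁻¹ • ((4 / (1 - ‖x‖ ^ 2) ^ 2) •
      innerSL ℝ (conformalField e x))) v
      = (Real.cosh (hyperplaneDist e x))⁻¹ * hypMetric n x (conformalField e x) v := by
    simp [hypMetric]
  rw [h2, mul_pow, inv_pow, inv_mul_le_iff₀ (by positivity)]
  exact h

/-! ### Translations along geodesics of the hyperplane -/

theorem hypTranslation_of_inner_eq_zero {e a : EuclideanSpace ℝ (Fin n)} (he : ‖e‖ = 1)
    (ha : inner ℝ a e = 0) (t : ℝ) :
    hypTranslation a (t • e) =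
      (1 + ‖a‖ ^ 2 * t ^ 2)⁻¹ • ((1 + t ^ 2) • a + ((1 - ‖a‖ ^ 2) * t) • e) := by
  simp [hypTranslation, real_inner_smul_right, ha, norm_smul, he, mul_smul]

theorem one_sub_norm_sq_hypTranslation {e a : EuclideanSpace ℝ (Fin n)} (he : ‖e‖ = 1)
    (ha : inner ℝ a e = 0) (t : ℝ) :
    1 - ‖hypTranslation a (t • e)‖ ^ 2
      = (1 - ‖a‖ ^ 2) * (1 - t ^ 2) / (1 + ‖a‖ ^ 2 * t ^ 2) := by
  have h0 : (1 + ‖a‖ ^ 2 * t ^ 2) ≠ 0 := by positivity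
  have hee : inner ℝ e e = (1 : ℝ) := by rw [real_inner_self_eq_norm_sq, he, one_pow]
  have hea : inner ℝ e a = (0 : ℝ) := by rw [real_inner_comm, ha]
  rw [hypTranslation_of_inner_eq_zero he ha,
    ← real_inner_self_eq_norm_sq ((1 + ‖a‖ ^ 2 * t ^ 2)⁻¹ • _)]
  simp only [inner_add_left, inner_add_right, real_inner_smul_left, real_inner_smul_right, hee,
    real_inner_self_eq_norm_sq a, ha, hea]
  field_simp
  ring

theorem inner_hypTranslation {e a : EuclideanSpace ℝ (Fin n)} (he : ‖e‖ = 1)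
    (ha : inner ℝ a e = 0) (t : ℝ) :
    inner ℝ (hypTranslation a (t • e)) e = (1 - ‖a‖ ^ 2) * t / (1 + ‖a‖ ^ 2 * t ^ 2) := by
  rw [hypTranslation_of_inner_eq_zero he ha]
  simp only [inner_add_left, real_inner_smul_left, real_inner_self_eq_norm_sq, he, ha]
  ring

theorem tanh_half_sq_lt_one (ρ : ℝ) : Real.tanh (ρ / 2) ^ 2 < 1 :=
  (sq_lt_one_iff_abs_lt_one _).2 (Real.abs_tanh_lt_one _)

theorem two_mul_tanh_half_div (ρ : ℝ) :
    2 * Real.tanh (ρ / 2) / (1 - Real.tanh (ρ / 2) ^ 2) = Real.sinh ρ := by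
  have h := Real.sinh_two_mul (ρ / 2)
  rw [mul_div_cancel₀ _ (two_ne_zero)] at h
  have hc := (Real.cosh_pos (ρ / 2)).ne'
  have h1 : 1 - Real.tanh (ρ / 2) ^ 2 = 1 / Real.cosh (ρ / 2) ^ 2 := by
    rw [Real.tanh_eq_sinh_div_cosh]; field_simp; rw [Real.cosh_sq]; ring
  rw [h1, h, Real.tanh_eq_sinh_div_cosh]
  field_simp

theorem hypTranslation_mem_ball {e a : EuclideanSpace ℝ (Fin n)} (he : ‖e‖ = 1)
    (ha : a ∈ hyperplane e) (ρ : ℝ) : hypTranslation a (Real.tanh (ρ / 2) • e) ∈ ball n := by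
  have h := one_sub_norm_sq_hypTranslation he ha.2 (Real.tanh (ρ / 2))
  have h1 := one_sub_norm_sq_pos ha.1
  have h2 := tanh_half_sq_lt_one ρ
  have h3 : 0 < (1 - ‖a‖ ^ 2) * (1 - Real.tanh (ρ / 2) ^ 2) /
      (1 + ‖a‖ ^ 2 * Real.tanh (ρ / 2) ^ 2) := by
    have : 0 < 1 - Real.tanh (ρ / 2) ^ 2 := by linarith
    positivity
  rw [← h] at h3
  exact (sq_lt_one_iff₀ (norm_nonneg _)).1 (by linarith)

/-- In the quotient defining `sinhDist` the factors 1 - |a|² and 1 + |a|² t² cancel, leaving 2t / (1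
- t²), which is sinh ρ for t = tanh (ρ/2). -/
theorem hyperplaneDist_hypTranslation {e a : EuclideanSpace ℝ (Fin n)} (he : ‖e‖ = 1)
    (ha : a ∈ hyperplane e) (ρ : ℝ) :
    hyperplaneDist e (hypTranslation a (Real.tanh (ρ / 2) • e)) = ρ := by
  have h1 := one_sub_norm_sq_pos ha.1
  have h2 : 0 < 1 - Real.tanh (ρ / 2) ^ 2 := by linarith [tanh_half_sq_lt_one ρ]
  rw [hyperplaneDist, sinhDist, one_sub_norm_sq_hypTranslation he ha.2, inner_hypTranslation he ha.2]
  refine Eq.trans (congrArg Real.arsinh ?_) (Real.arsinh_sinh ρ)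
  rw [← two_mul_tanh_half_div ρ]
  field_simp

theorem tanh_half_eq (ρ : ℝ) :
    Real.tanh (ρ / 2) = Real.sinh ρ / (1 + Real.cosh ρ) := by
  have hs := Real.sinh_two_mul (ρ / 2)
  have hc := Real.cosh_two_mul (ρ / 2)
  rw [mul_div_cancel₀ _ (two_ne_zero)] at hs hc
  have hc0 := (Real.cosh_pos (ρ / 2)).ne'
  have h1 : 1 + Real.cosh ρ = 2 * Real.cosh (ρ / 2) ^ 2 := by
    rw [hc, Real.sinh_sq]; ring
  rw [h1, hs, Real.tanh_eq_sinh_div_cosh]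
  field_simp

/-- Every point of the ball lies on the geodesic orthogonal to the hyperplane at some point. -/
theorem exists_hypTranslation_eq {e x : EuclideanSpace ℝ (Fin n)} (he : ‖e‖ = 1)
    (hx : x ∈ ball n) :
    ∃ a ∈ hyperplane e, x = hypTranslation a (Real.tanh (hyperplaneDist e x / 2) • e) := by
  obtain ⟨s, hs⟩ : ∃ s, s = inner ℝ x e := ⟨_, rfl⟩
  obtain ⟨d, hd⟩ : ∃ d, d = 1 - ‖x‖ ^ 2 := ⟨_, rfl⟩
  obtain ⟨K, hK⟩ : ∃ K, K = d * Real.cosh (hyperplaneDist e x) := ⟨_, rfl⟩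
  have hd0 : 0 < d := hd ▸ one_sub_norm_sq_pos hx
  have hd1 : d ≤ 1 := by rw [hd]; nlinarith [sq_nonneg ‖x‖]
  have hK0 : 0 < K := by rw [hK]; exact mul_pos hd0 (Real.cosh_pos _)
  have hsinh : Real.sinh (hyperplaneDist e x) = 2 * s / d := by
    rw [sinh_hyperplaneDist, sinhDist, hs, hd]
  have hK2 : K ^ 2 = d ^ 2 + 4 * s ^ 2 := by
    rw [hK, mul_pow, Real.cosh_sq, hsinh]; field_simp; ring
  have ht : Real.tanh (hyperplaneDist e x / 2) = 2 * s / (d + K) := by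
    rw [tanh_half_eq, hsinh, hK]; field_simp
  have hy : ‖x - s • e‖ ^ 2 = 1 - d - s ^ 2 := by
    rw [norm_sub_sq_real, real_inner_smul_right, norm_smul, he, ← hs, hd, Real.norm_eq_abs,
      mul_one, sq_abs]
    ring
  have hP : 0 < 2 - d + K := by linarith
  -- The foot of the perpendicular from x. Its direction is the part of x orthogonal to e; the
  -- factor is (1 + |a|² t²) / (1 + t²) with t = tanh (ρ/2), obtained by inverting the formula for
  -- the translation.
  set a := (2 / (2 - d + K)) • (x - s • e) with ha
  have ha2 : ‖a‖ ^ 2 = (2 - d - K) / (2 - d + K) := by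
    rw [ha, norm_smul, mul_pow, hy, Real.norm_eq_abs, sq_abs]
    field_simp
    linear_combination hK2
  have haball : a ∈ ball n := by
    refine (sq_lt_one_iff₀ (norm_nonneg _)).1 ?_
    rw [ha2, div_lt_one hP]; linarith
  have hae : inner ℝ a e = 0 := by
    rw [ha, real_inner_smul_left, inner_sub_left, real_inner_smul_left,
      real_inner_self_eq_norm_sq, he, ← hs]
    ring
  refine ⟨a, ⟨haball, hae⟩, ?_⟩
  have ht2 : (2 * s / (d + K)) ^ 2 = (K - d) / (d + K) := by
    field_simp
    linear_combination -hK2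
  have hden : 1 + (2 - d - K) / (2 - d + K) * ((K - d) / (d + K))
      = 4 * K / ((2 - d + K) * (d + K)) := by
    field_simp
    ring
  rw [hypTranslation_of_inner_eq_zero he hae, ht, ht2, ha2, hden, smul_add, smul_smul, ha,
    smul_smul, smul_smul]
  have h1 : (4 * K / ((2 - d + K) * (d + K)))⁻¹ * (1 + (K - d) / (d + K)) * (2 / (2 - d + K))
      = 1 := by
    field_simp
    ring
  have h2 : (4 * K / ((2 - d + K) * (d + K)))⁻¹ * ((1 - (2 - d - K) / (2 - d + K)) *
      (2 * s / (d + K))) = s := by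
    field_simp
    ring
  rw [h1, h2, one_smul, sub_add_cancel]

/-! ### Lengths of curves and distances -/

section Length

variable {E : Type*} [NormedAddCommGroup E] [NormedSpace ℝ E]
  {G : Type*} [NormedAddCommGroup G] [NormedSpace ℝ G] [CompleteSpace G]

/-- A function which is `1`-Lipschitz infinitesimally is `1`-Lipschitz for the intrinsic
distance. -/
theorem ofReal_norm_sub_le_intrinsicEDist {g : E → E → E → ℝ} {S U : Set E} (hU : IsOpen U)
    (hSU : S ⊆ U) (hg : ContinuousOn (fun q : E × E => g q.1 q.2 q.2) (U ×ˢ univ))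
    {F : E → G} (hF : ContDiffOn ℝ 1 F U)
    (hb : ∀ p ∈ U, ∀ v, ‖fderiv ℝ F p v‖ ≤ Real.sqrt (g p v v)) (x y : E) :
    ENNReal.ofReal ‖F y - F x‖ ≤ intrinsicEDist g S x y := by
  refine le_iInf₂ fun c ⟨hc, h0, h1, hS⟩ => ENNReal.ofReal_le_ofReal ?_
  have hcU : ∀ s ∈ Icc (0 : ℝ) 1, c s ∈ U := fun s hs => hSU (hS s hs)
  have hc' : Continuous (deriv c) := hc.continuous_deriv le_rfl
  have hd : ∀ s ∈ Icc (0 : ℝ) 1,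
      HasDerivAt (fun s => F (c s)) (fderiv ℝ F (c s) (deriv c s)) s := fun s hs =>
    (((hF.differentiableOn one_ne_zero).differentiableAt
      (hU.mem_nhds (hcU s hs))).hasFDerivAt).comp_hasDerivAt s
      (hc.differentiable one_ne_zero s).hasDerivAt
  have hcont : ContinuousOn (fun s => fderiv ℝ F (c s) (deriv c s)) (Icc 0 1) :=
    ((hF.continuousOn_fderiv_of_isOpen hU le_rfl).comp hc.continuous.continuousOn hcU).clm_apply
      hc'.continuousOn
  -- The length is a Bochner integral, which would be 0 for a non-integrable speed; continuity of
  -- the metric excludes this.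
  have hgc : ContinuousOn (fun s => Real.sqrt (g (c s) (deriv c s) (deriv c s))) (Icc 0 1) :=
    (hg.comp (hc.continuous.prodMk hc').continuousOn
      fun s hs => ⟨hcU s hs, mem_univ _⟩).sqrt
  have hint := intervalIntegral.integral_eq_sub_of_hasDerivAt (a := 0) (b := 1)
    (f := fun s => F (c s)) (f' := fun s => fderiv ℝ F (c s) (deriv c s))
    (by rw [uIcc_of_le zero_le_one]; exact hd)
    (ContinuousOn.intervalIntegrable (by rwa [uIcc_of_le zero_le_one]))
  rw [← h0, ← h1, ← hint]
  refine intervalIntegral.norm_integral_le_of_norm_le zero_le_one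
    (Eventually.of_forall fun s hs => hb _ (hcU s (Ioc_subset_Icc_self hs)) _)
    (ContinuousOn.intervalIntegrable (by rwa [uIcc_of_le zero_le_one]))

theorem intrinsicEDist_le {g : E → E → E → ℝ} {S : Set E} {x y : E} {c : ℝ → E}
    (hc : ContDiff ℝ 1 c) (h0 : c 0 = x) (h1 : c 1 = y) (hS : ∀ s ∈ Icc (0 : ℝ) 1, c s ∈ S) :
    intrinsicEDist g S x y ≤ ENNReal.ofReal (curveLength g c) :=
  iInf₂_le c ⟨hc, h0, h1, hS⟩

end Length


theorem continuousOn_hypMetric :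
    ContinuousOn (fun q : EuclideanSpace ℝ (Fin n) × EuclideanSpace ℝ (Fin n) =>
      hypMetric n q.1 q.2 q.2) (ball n ×ˢ univ) := by
  refine ContinuousOn.mul (ContinuousOn.div (by fun_prop) (by fun_prop) fun q hq => ?_)
    (by fun_prop)
  exact pow_ne_zero 2 (one_sub_norm_sq_pos hq.1).ne'

theorem continuousOn_prodMetric :
    ContinuousOn (fun q : (EuclideanSpace ℝ (Fin n) × ℝ) × (EuclideanSpace ℝ (Fin n) × ℝ) =>
      prodMetric n q.1 q.2 q.2) ((Prod.fst ⁻¹' ball n) ×ˢ univ) := by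
  refine ContinuousOn.add ?_ (by fun_prop)
  exact continuousOn_hypMetric.comp (f := fun q : (EuclideanSpace ℝ (Fin n) × ℝ) ×
    (EuclideanSpace ℝ (Fin n) × ℝ) => (q.1.1, q.2.1)) (by fun_prop)
    fun q hq => ⟨hq.1, mem_univ _⟩

theorem hasDerivAt_tanh (x : ℝ) : HasDerivAt Real.tanh (1 - Real.tanh x ^ 2) x := by
  have h := (Real.hasDerivAt_sinh x).div (Real.hasDerivAt_cosh x) (Real.cosh_pos x).ne'
  have he : Real.tanh = fun x => Real.sinh x / Real.cosh x := funext Real.tanh_eq_sinh_div_cosh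
  rw [he]
  refine h.congr_deriv ?_
  have := (Real.cosh_pos x).ne'
  field_simp

theorem contDiff_tanh {m : WithTop ℕ∞} : ContDiff ℝ m Real.tanh := by
  have he : Real.tanh = fun x => Real.sinh x / Real.cosh x := funext Real.tanh_eq_sinh_div_cosh
  rw [he]
  exact Real.contDiff_sinh.div Real.contDiff_cosh fun x => (Real.cosh_pos x).ne'

theorem contDiff_hypTranslation {m : WithTop ℕ∞} {e a : EuclideanSpace ℝ (Fin n)} (he : ‖e‖ = 1)
    (ha : inner ℝ a e = 0) : ContDiff ℝ m fun t : ℝ => hypTranslation a (t • e) := by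
  simp only [hypTranslation_of_inner_eq_zero he ha]
  have h1 : ContDiff ℝ m fun t : ℝ => 1 + ‖a‖ ^ 2 * t ^ 2 := by fun_prop
  have h2 : ContDiff ℝ m fun t : ℝ => (1 + t ^ 2) • a + ((1 - ‖a‖ ^ 2) * t) • e := by fun_prop
  exact (h1.inv fun t => by positivity).smul h2

theorem hasDerivAt_hypTranslation {e a : EuclideanSpace ℝ (Fin n)} (he : ‖e‖ = 1)
    (ha : inner ℝ a e = 0) (t : ℝ) :
    HasDerivAt (fun t : ℝ => hypTranslation a (t • e))
      (((1 - ‖a‖ ^ 2) / (1 + ‖a‖ ^ 2 * t ^ 2) ^ 2) •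
        ((2 * t) • a + (1 - ‖a‖ ^ 2 * t ^ 2) • e)) t := by
  simp only [hypTranslation_of_inner_eq_zero he ha]
  have h0 : 1 + ‖a‖ ^ 2 * t ^ 2 ≠ 0 := by positivity
  have h1 : HasDerivAt (fun t : ℝ => (1 + ‖a‖ ^ 2 * t ^ 2)⁻¹)
      (-(‖a‖ ^ 2 * (2 * t)) / (1 + ‖a‖ ^ 2 * t ^ 2) ^ 2) t := by
    have := ((((hasDerivAt_id t).pow 2).const_mul (‖a‖ ^ 2)).const_add 1).inv h0
    refine this.congr_deriv ?_
    simp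
  have h2 : HasDerivAt (fun t : ℝ => (1 + t ^ 2) • a + ((1 - ‖a‖ ^ 2) * t) • e)
      ((2 * t) • a + (1 - ‖a‖ ^ 2) • e) t := by
    have h3 := ((((hasDerivAt_id t).pow 2).const_add 1).smul_const a).add
      (((hasDerivAt_id t).const_mul (1 - ‖a‖ ^ 2)).smul_const e)
    refine h3.congr_deriv ?_
    simp
  refine (h1.smul h2).congr_deriv ?_
  match_scalars <;> field_simp <;> ring

/-- The translation is an isometry, so the speed is that of the radial geodesic t • e and does not
involve a. -/
theorem hypMetric_deriv_hypTranslation {e a : EuclideanSpace ℝ (Fin n)} (he : ‖e‖ = 1)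
    (ha : a ∈ hyperplane e) {t : ℝ} (ht : t ^ 2 < 1) (b : ℝ) :
    hypMetric n (hypTranslation a (t • e))
      (b • ((1 - ‖a‖ ^ 2) / (1 + ‖a‖ ^ 2 * t ^ 2) ^ 2) •
        ((2 * t) • a + (1 - ‖a‖ ^ 2 * t ^ 2) • e))
      (b • ((1 - ‖a‖ ^ 2) / (1 + ‖a‖ ^ 2 * t ^ 2) ^ 2) •
        ((2 * t) • a + (1 - ‖a‖ ^ 2 * t ^ 2) • e)) = (2 * b / (1 - t ^ 2)) ^ 2 := by
  have hee : inner ℝ e e = (1 : ℝ) := by rw [real_inner_self_eq_norm_sq, he, one_pow]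
  have hea : inner ℝ e a = (0 : ℝ) := by rw [real_inner_comm, ha.2]
  have h0 : 1 + ‖a‖ ^ 2 * t ^ 2 ≠ 0 := by positivity
  have h1 := (one_sub_norm_sq_pos ha.1).ne'
  have h2 : 1 - t ^ 2 ≠ 0 := by linarith
  rw [hypMetric, one_sub_norm_sq_hypTranslation he ha.2]
  simp only [inner_add_left, inner_add_right, real_inner_smul_left, real_inner_smul_right, hee,
    real_inner_self_eq_norm_sq a, ha.2, hea]
  field_simp
  ring

theorem intrinsicEDist_hypTranslation_le {e a : EuclideanSpace ℝ (Fin n)} (he : ‖e‖ = 1)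
    (ha : a ∈ hyperplane e) {ρ : ℝ} (hρ : 0 ≤ ρ) :
    intrinsicEDist (hypMetric n) (ball n) (hypTranslation a (Real.tanh (ρ / 2) • e)) a
      ≤ ENNReal.ofReal ρ := by
  have hτ : ∀ s, HasDerivAt (fun s : ℝ => Real.tanh ((1 - s) * ρ / 2))
      ((1 - Real.tanh ((1 - s) * ρ / 2) ^ 2) * (-ρ / 2)) s := fun s => by
    refine (hasDerivAt_tanh _).comp s (h := fun s : ℝ => (1 - s) * ρ / 2) ?_
    refine ((((hasDerivAt_id s).const_sub 1).mul_const ρ).div_const 2).congr_deriv ?_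
    ring
  have hlen : curveLength (hypMetric n)
      (fun s : ℝ => hypTranslation a (Real.tanh ((1 - s) * ρ / 2) • e)) = ρ := by
    have h : ∀ s : ℝ, Real.sqrt (hypMetric n (hypTranslation a (Real.tanh ((1 - s) * ρ / 2) • e))
        (deriv (fun s : ℝ => hypTranslation a (Real.tanh ((1 - s) * ρ / 2) • e)) s)
        (deriv (fun s : ℝ => hypTranslation a (Real.tanh ((1 - s) * ρ / 2) • e)) s)) = ρ := by
      intro s
      have hd := (hasDerivAt_hypTranslation he ha.2 (Real.tanh ((1 - s) * ρ / 2))).scomp s (hτ s)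
      have h1 := tanh_half_sq_lt_one ((1 - s) * ρ)
      have h2 : 1 - Real.tanh ((1 - s) * ρ / 2) ^ 2 ≠ 0 := by linarith
      rw [show deriv (fun s : ℝ => hypTranslation a (Real.tanh ((1 - s) * ρ / 2) • e)) s = _
        from hd.deriv, hypMetric_deriv_hypTranslation he ha h1, Real.sqrt_sq_eq_abs,
        show 2 * ((1 - Real.tanh ((1 - s) * ρ / 2) ^ 2) * (-ρ / 2)) /
          (1 - Real.tanh ((1 - s) * ρ / 2) ^ 2) = -ρ by field_simp, abs_neg, abs_of_nonneg hρ]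
    simp only [curveLength, h]
    simp
  -- The orthogonal geodesic, run at constant speed ρ from the point down to its foot a.
  refine (intrinsicEDist_le (c := fun s : ℝ =>
    hypTranslation a (Real.tanh ((1 - s) * ρ / 2) • e)) ?_ ?_ ?_ ?_).trans_eq
      (congrArg ENNReal.ofReal hlen)
  · exact (contDiff_hypTranslation he ha.2).comp (contDiff_tanh.comp (by fun_prop))
  · simp
  · simp [hypTranslation]
  · exact fun s _ => hypTranslation_mem_ball he ha _

/-- The orthogonal geodesic through x realizes the upper bound. Conversely d is 1-Lipschitz and
vanishes on the hyperplane, so no curve is shorter. -/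
theorem iInf_intrinsicEDist_hyperplane {e x : EuclideanSpace ℝ (Fin n)} (he : ‖e‖ = 1)
    (hx : x ∈ ball n) (hρ : 0 ≤ hyperplaneDist e x) :
    ⨅ y ∈ hyperplane e, intrinsicEDist (hypMetric n) (ball n) x y
      = ENNReal.ofReal (hyperplaneDist e x) := by
  apply le_antisymm
  · obtain ⟨a, ha, hxa⟩ := exists_hypTranslation_eq he hx
    refine (iInf₂_le a ha).trans ?_
    have := intrinsicEDist_hypTranslation_le he ha hρ
    rwa [← hxa] at this
  · refine le_iInf₂ fun y hy => ?_
    have h := ofReal_norm_sub_le_intrinsicEDist isOpen_ball Subset.rfl continuousOn_hypMetric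
      ((contDiffOn_hyperplaneDist e).of_le (by exact_mod_cast le_top))
      (fun p hp v => norm_fderiv_hyperplaneDist_le he hp v) x y
    have hy0 : hyperplaneDist e y = 0 := by simp [hyperplaneDist, sinhDist, hy.2]
    rwa [hy0, zero_sub, norm_neg, Real.norm_of_nonneg hρ] at h

theorem hyperplaneDist_pos_iff {e x : EuclideanSpace ℝ (Fin n)} (hx : x ∈ ball n) :
    0 < hyperplaneDist e x ↔ 0 < inner ℝ x e := by
  rw [hyperplaneDist, Real.arsinh_pos_iff, sinhDist, div_pos_iff_of_pos_right (one_sub_norm_sq_pos hx)]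
  simp

theorem equidistant_eq {e : EuclideanSpace ℝ (Fin n)} (he : ‖e‖ = 1) {r : ℝ} (hr : 0 < r) :
    equidistant e r = {x | x ∈ ball n ∧ hyperplaneDist e x = r} := by
  ext x
  simp only [equidistant, mem_ofPred_eq]
  refine and_congr_right fun hx => ?_
  rw [← hyperplaneDist_pos_iff hx]
  constructor
  · rintro ⟨h0, h⟩
    rwa [iInf_intrinsicEDist_hyperplane he hx h0.le,
      ENNReal.ofReal_eq_ofReal_iff h0.le hr.le] at h
  · rintro rfl
    exact ⟨hr, iInf_intrinsicEDist_hyperplane he hx hr.le⟩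

/-! ### The generating curve -/

/-- The solution `φ` of `φ' + k tanh ρ φ = k tanh r` with `φ r = 1`. -/
def profile (k : ℕ) (r ρ : ℝ) : ℝ :=
  (Real.cosh r ^ k + k * Real.tanh r * ∫ s in r..ρ, Real.cosh s ^ k) / Real.cosh ρ ^ k

/-- The slope of the generating curve whose angle function is `profile k r`. -/
def slope (k : ℕ) (r ρ : ℝ) : ℝ := profile k r ρ / Real.sqrt (1 - profile k r ρ ^ 2)

/-- The height of the generating curve. -/
def height (k : ℕ) (r ρ : ℝ) : ℝ := ∫ s in (r + 1)..ρ, slope k r s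

variable {k : ℕ} {r : ℝ}

theorem hasDerivAt_integral_cosh_pow (k : ℕ) (r ρ : ℝ) :
    HasDerivAt (fun ρ => ∫ s in r..ρ, Real.cosh s ^ k) (Real.cosh ρ ^ k) ρ :=
  (Real.continuous_cosh.pow k).integral_hasStrictDerivAt r ρ |>.hasDerivAt

theorem hasDerivAt_cosh_pow (k : ℕ) (ρ : ℝ) :
    HasDerivAt (fun ρ => Real.cosh ρ ^ k) (k * Real.tanh ρ * Real.cosh ρ ^ k) ρ := by
  have hc := (Real.cosh_pos ρ).ne'
  refine ((Real.hasDerivAt_cosh ρ).pow k).congr_deriv ?_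
  rcases k with _ | k
  · simp
  · rw [Real.tanh_eq_sinh_div_cosh, Nat.add_sub_cancel, pow_succ (Real.cosh ρ) k]
    field_simp

theorem hasDerivAt_profile (k : ℕ) (r ρ : ℝ) :
    HasDerivAt (profile k r) (k * Real.tanh r - k * Real.tanh ρ * profile k r ρ) ρ := by
  have hc := (pow_pos (Real.cosh_pos ρ) k).ne'
  refine ((((hasDerivAt_integral_cosh_pow k r ρ).const_mul (k * Real.tanh r)).const_add
    (Real.cosh r ^ k)).div (hasDerivAt_cosh_pow k ρ) hc).congr_deriv ?_
  rw [profile]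
  field_simp

theorem profile_self (k : ℕ) (r : ℝ) : profile k r r = 1 := by
  simp [profile, (Real.cosh_pos r).ne']

theorem contDiff_profile (k : ℕ) (r : ℝ) : ContDiff ℝ ∞ (profile k r) := by
  refine ContDiff.div (contDiff_const.add (contDiff_const.mul ?_)) (Real.contDiff_cosh.pow k)
    fun x => (pow_pos (Real.cosh_pos x) k).ne'
  refine contDiff_infty_iff_deriv.2 ⟨fun x => (hasDerivAt_integral_cosh_pow k r x).differentiableAt,
    ?_⟩
  rw [show deriv (fun ρ => ∫ s in r..ρ, Real.cosh s ^ k) = fun ρ => Real.cosh ρ ^ k from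
    funext fun x => (hasDerivAt_integral_cosh_pow k r x).deriv]
  exact Real.contDiff_cosh.pow k

theorem strictMono_tanh : StrictMono Real.tanh := by
  refine strictMono_of_deriv_pos fun x => ?_
  rw [(hasDerivAt_tanh x).deriv, sub_pos]
  exact (sq_lt_one_iff_abs_lt_one _).2 (Real.abs_tanh_lt_one _)

theorem tanh_pos {x : ℝ} (hx : 0 < x) : 0 < Real.tanh x := by
  simpa using strictMono_tanh hx

/-- `profile k r` is compared with a constant through `cosh ^ k * (profile - a)`. -/
theorem hasDerivAt_cosh_pow_mul_profile_sub (k : ℕ) (r a ρ : ℝ) :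
    HasDerivAt (fun ρ => Real.cosh ρ ^ k * (profile k r ρ - a))
      (k * Real.cosh ρ ^ k * (Real.tanh r - a * Real.tanh ρ)) ρ := by
  refine ((hasDerivAt_cosh_pow k ρ).mul ((hasDerivAt_profile k r ρ).sub_const a)).congr_deriv ?_
  ring

/-- Since tanh ρ > tanh r beyond r, the function cosh^k (φ - 1) strictly decreases from its value 0
at r. -/
theorem profile_lt_one (hk : 0 < k) {ρ : ℝ} (hρ : r < ρ) : profile k r ρ < 1 := by
  have hanti : StrictAntiOn (fun ρ => Real.cosh ρ ^ k * (profile k r ρ - 1)) (Ici r) := by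
    refine strictAntiOn_of_deriv_neg (convex_Ici r)
      (fun x _ => (hasDerivAt_cosh_pow_mul_profile_sub k r 1 x).continuousAt.continuousWithinAt)
      fun x hx => ?_
    rw [interior_Ici] at hx
    rw [(hasDerivAt_cosh_pow_mul_profile_sub k r 1 x).deriv]
    have := strictMono_tanh (mem_Ioi.1 hx)
    have h2 := Real.cosh_pos x
    exact mul_neg_of_pos_of_neg (by positivity) (by linarith)
  have h := hanti self_mem_Ici hρ.le hρ
  simp only [profile_self, sub_self, mul_zero] at h
  by_contra hcon
  push Not at hcon
  exact absurd h (not_lt.2 (mul_nonneg (pow_pos (Real.cosh_pos ρ) k).le (by linarith)))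

/-- Since tanh < 1, the function cosh^k (φ - tanh r) is nondecreasing, and it starts at a
nonnegative value. -/
theorem tanh_le_profile (hr : 0 < r) {ρ : ℝ} (hρ : r ≤ ρ) : Real.tanh r ≤ profile k r ρ := by
  have hmono : MonotoneOn (fun ρ => Real.cosh ρ ^ k * (profile k r ρ - Real.tanh r)) (Ici r) := by
    refine monotoneOn_of_deriv_nonneg (convex_Ici r)
      (fun x _ => (hasDerivAt_cosh_pow_mul_profile_sub k r _ x).continuousAt.continuousWithinAt)
      (fun x _ =>
        (hasDerivAt_cosh_pow_mul_profile_sub k r _ x).differentiableAt.differentiableWithinAt)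
      fun x hx => ?_
    rw [(hasDerivAt_cosh_pow_mul_profile_sub k r _ x).deriv]
    have h1 := tanh_pos hr
    have h2 := Real.cosh_pos x
    have h3 := (Real.tanh_lt_one x).le
    have : Real.tanh r * Real.tanh x ≤ Real.tanh r := mul_le_of_le_one_right h1.le h3
    exact mul_nonneg (by positivity) (by linarith)
  have h := hmono self_mem_Ici hρ hρ
  simp only [profile_self] at h
  have h0 : 0 ≤ Real.cosh r ^ k * (1 - Real.tanh r) :=
    mul_nonneg (pow_pos (Real.cosh_pos r) k).le (by linarith [Real.tanh_lt_one r])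
  have := nonneg_of_mul_nonneg_right (h0.trans h) (pow_pos (Real.cosh_pos ρ) k)
  linarith

theorem profile_pos (hr : 0 < r) {ρ : ℝ} (hρ : r ≤ ρ) : 0 < profile k r ρ :=
  (tanh_pos hr).trans_le (tanh_le_profile hr hρ)

theorem one_sub_profile_sq_pos (hk : 0 < k) (hr : 0 < r) {ρ : ℝ} (hρ : r < ρ) :
    0 < 1 - profile k r ρ ^ 2 := by
  have h1 := profile_lt_one hk hρ
  have h2 := profile_pos (k := k) hr hρ.le
  nlinarith

/-- Second-order contact with 1 at r: because φ ≤ 1 and tanh is 1-Lipschitz, -φ' = k (tanh ρ φ -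
tanh r) ≤ k (ρ - r), and this is integrated from r. -/
theorem one_sub_profile_le (hk : 0 < k) (hr : 0 < r) {ρ : ℝ} (hρ : r ≤ ρ) :
    1 - profile k r ρ ≤ k * (ρ - r) ^ 2 / 2 := by
  have hd : ∀ x, HasDerivAt (fun x => k * (x - r) ^ 2 / 2 - (1 - profile k r x))
      (k * (x - r) + (k * Real.tanh r - k * Real.tanh x * profile k r x)) x := fun x => by
    refine ((((((hasDerivAt_id x).sub_const r).pow 2).const_mul (k : ℝ)).div_const 2).sub
      ((hasDerivAt_profile k r x).const_sub 1)).congr_deriv ?_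
    simp
    ring
  have htanh : ∀ x, r ≤ x → Real.tanh x - Real.tanh r ≤ x - r := by
    have hd' : ∀ x, HasDerivAt (fun x => x - Real.tanh x) (1 - (1 - Real.tanh x ^ 2)) x :=
      fun x => (hasDerivAt_id x).sub (hasDerivAt_tanh x)
    have hm : Monotone (fun x => x - Real.tanh x) := by
      refine monotone_of_deriv_nonneg (fun x => (hd' x).differentiableAt) fun x => ?_
      rw [(hd' x).deriv]
      nlinarith [sq_nonneg (Real.tanh x)]
    intro x hx
    have := hm hx
    simp only at this
    linarith
  have hmono : MonotoneOn (fun x => k * (x - r) ^ 2 / 2 - (1 - profile k r x)) (Ici r) := by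
    refine monotoneOn_of_deriv_nonneg (convex_Ici r)
      (fun x _ => (hd x).continuousAt.continuousWithinAt)
      (fun x _ => (hd x).differentiableAt.differentiableWithinAt) fun x hx => ?_
    rw [interior_Ici] at hx
    rw [(hd x).deriv]
    have h1 := htanh x (mem_Ioi.1 hx).le
    have h2 := (profile_lt_one hk hx).le
    have h3 : 0 ≤ Real.tanh x := (tanh_pos (hr.trans hx)).le
    have h4 : Real.tanh x * profile k r x ≤ Real.tanh x := mul_le_of_le_one_right h3 h2
    have h5 : (0 : ℝ) ≤ k := by positivity
    nlinarith [mul_nonneg h5 (show 0 ≤ (x - r) + Real.tanh r - Real.tanh x * profile k r x by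
      linarith)]
  have h := hmono self_mem_Ici hρ hρ
  simp [profile_self] at h
  linarith

theorem contDiffOn_slope (hk : 0 < k) (hr : 0 < r) : ContDiffOn ℝ ∞ (slope k r) (Ioi r) :=
  (contDiff_profile k r).contDiffOn.div
    (((contDiff_const.sub ((contDiff_profile k r).pow 2)).contDiffOn).sqrt
      fun _ hx => (one_sub_profile_sq_pos hk hr hx).ne')
    fun _ hx => (Real.sqrt_pos.2 (one_sub_profile_sq_pos hk hr hx)).ne'

theorem slope_pos (hk : 0 < k) (hr : 0 < r) {ρ : ℝ} (hρ : r < ρ) : 0 < slope k r ρ :=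
  div_pos (profile_pos hr hρ.le) (Real.sqrt_pos.2 (one_sub_profile_sq_pos hk hr hρ))

theorem hasDerivAt_height (hk : 0 < k) (hr : 0 < r) {ρ : ℝ} (hρ : r < ρ) :
    HasDerivAt (height k r) (slope k r ρ) ρ := by
  have hc := (contDiffOn_slope hk hr).continuousOn
  have hsub : uIcc (r + 1) ρ ⊆ Ioi r := fun x hx => by
    rcases le_total (r + 1) ρ with h | h
    · rw [uIcc_of_le h] at hx; exact (lt_add_one r).trans_le hx.1
    · rw [uIcc_of_ge h] at hx; exact hρ.trans_le hx.1
  exact intervalIntegral.integral_hasDerivAt_right (hc.mono hsub).intervalIntegrable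
    (hc.stronglyMeasurableAtFilter isOpen_Ioi ρ hρ) (hc.continuousAt (Ioi_mem_nhds hρ))

theorem contDiffOn_height (hk : 0 < k) (hr : 0 < r) : ContDiffOn ℝ ∞ (height k r) (Ioi r) := by
  refine (contDiffOn_infty_iff_deriv_of_isOpen isOpen_Ioi).2
    ⟨fun x hx => (hasDerivAt_height hk hr hx).differentiableAt.differentiableWithinAt, ?_⟩
  exact (contDiffOn_slope hk hr).congr fun x hx => (hasDerivAt_height hk hr hx).deriv

theorem strictMonoOn_height (hk : 0 < k) (hr : 0 < r) : StrictMonoOn (height k r) (Ioi r) := by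
  refine strictMonoOn_of_deriv_pos (convex_Ioi r) (contDiffOn_height hk hr).continuousOn
    fun x hx => ?_
  rw [interior_Ioi] at hx
  rw [(hasDerivAt_height hk hr hx).deriv]
  exact slope_pos hk hr hx

/-- The slope is at least φ, hence at least tanh r, so the height grows at least linearly. -/
theorem tendsto_height_atTop (hk : 0 < k) (hr : 0 < r) : Tendsto (height k r) atTop atTop := by
  have hκ := tanh_pos hr
  have hd : ∀ x ∈ Ioi r, HasDerivAt (fun x => height k r x - Real.tanh r * x)
      (slope k r x - Real.tanh r) x := fun x hx => by
    exact ((hasDerivAt_height hk hr hx).sub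
      ((hasDerivAt_id x).const_mul (Real.tanh r))).congr_deriv (by rw [mul_one])
  have hmono : MonotoneOn (fun x => height k r x - Real.tanh r * x) (Ioi r) := by
    refine monotoneOn_of_deriv_nonneg (convex_Ioi r)
      (fun x hx => (hd x hx).continuousAt.continuousWithinAt)
      (fun x hx => (hd x (interior_subset hx)).differentiableAt.differentiableWithinAt)
      fun x hx => ?_
    rw [interior_Ioi] at hx
    rw [(hd x hx).deriv, sub_nonneg, slope, le_div_iff₀
      (Real.sqrt_pos.2 (one_sub_profile_sq_pos hk hr hx))]
    refine le_trans (mul_le_of_le_one_right hκ.le (Real.sqrt_le_one.2 ?_))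
      (tanh_le_profile hr (mem_Ioi.1 hx).le)
    nlinarith [sq_nonneg (profile k r x)]
  have hlin : Tendsto (fun x => Real.tanh r * x +
      (height k r (r + 1) - Real.tanh r * (r + 1))) atTop atTop :=
    tendsto_atTop_add_const_right _ _ (tendsto_id.const_mul_atTop hκ)
  refine tendsto_atTop_mono' _ ?_ hlin
  filter_upwards [eventually_ge_atTop (r + 1)] with x hx
  have := hmono (mem_Ioi.2 (lt_add_one r)) (mem_Ioi.2 ((lt_add_one r).trans_le hx)) hx
  simp only at this
  linarith

/-- From 1 - φ² ≤ 2 (1 - φ) ≤ k (ρ - r)² and φ ≥ tanh r, the slope is at least c / (ρ - r) with c =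
tanh r / √k. Comparison with c log (ρ - r) gives the divergence. -/
theorem tendsto_height_atBot (hk : 0 < k) (hr : 0 < r) :
    Tendsto (height k r) (𝓝[>] r) atBot := by
  have hκ := tanh_pos hr
  have hk' : (0 : ℝ) < k := by exact_mod_cast hk
  set c := Real.tanh r / Real.sqrt k with hc
  have hc0 : 0 < c := div_pos hκ (Real.sqrt_pos.2 hk')
  have hd : ∀ x ∈ Ioi r, HasDerivAt (fun x => height k r x - c * Real.log (x - r))
      (slope k r x - c * (1 / (x - r))) x := fun x hx => by
    have hx0 : x - r ≠ 0 := (sub_pos.2 (mem_Ioi.1 hx)).ne'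
    exact (hasDerivAt_height hk hr hx).sub
      ((((hasDerivAt_id x).sub_const r).log hx0).const_mul c)
  have hmono : MonotoneOn (fun x => height k r x - c * Real.log (x - r)) (Ioi r) := by
    refine monotoneOn_of_deriv_nonneg (convex_Ioi r)
      (fun x hx => (hd x hx).continuousAt.continuousWithinAt)
      (fun x hx => (hd x (interior_subset hx)).differentiableAt.differentiableWithinAt)
      fun x hx => ?_
    rw [interior_Ioi] at hx
    have hx0 : 0 < x - r := sub_pos.2 (mem_Ioi.1 hx)
    have hle : Real.sqrt (1 - profile k r x ^ 2) ≤ Real.sqrt k * (x - r) := by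
      refine Real.sqrt_le_iff.2 ⟨by positivity, ?_⟩
      rw [mul_pow, Real.sq_sqrt hk'.le]
      have h1 := one_sub_profile_le hk hr (mem_Ioi.1 hx).le
      have h2 := profile_lt_one hk hx
      nlinarith [sq_nonneg (1 - profile k r x)]
    rw [(hd x hx).deriv, sub_nonneg, slope, hc, div_mul_div_comm, mul_one]
    exact div_le_div₀ (profile_pos hr (mem_Ioi.1 hx).le).le
      (tanh_le_profile hr (mem_Ioi.1 hx).le)
      (Real.sqrt_pos.2 (one_sub_profile_sq_pos hk hr hx)) hle
  have hlog : Tendsto (fun x => c * Real.log (x - r) + height k r (r + 1)) (𝓝[>] r) atBot := by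
    refine tendsto_atBot_add_const_right _ _ (Tendsto.const_mul_atBot hc0 ?_)
    refine Real.tendsto_log_nhdsGT_zero.comp (tendsto_nhdsWithin_iff.2 ⟨?_, ?_⟩)
    · have : Tendsto (fun x => x - r) (𝓝 r) (𝓝 (r - r)) := tendsto_id.sub_const r
      rw [sub_self] at this
      exact this.mono_left nhdsWithin_le_nhds
    · filter_upwards [self_mem_nhdsWithin] with x hx using sub_pos.2 (mem_Ioi.1 hx)
  refine tendsto_atBot_mono' _ ?_ hlog
  filter_upwards [Ioc_mem_nhdsGT (lt_add_one r)] with x hx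
  have := hmono hx.1 (mem_Ioi.2 (lt_add_one r)) hx.2
  simp at this
  linarith

/-! ### Covariant derivatives -/

theorem hasFDerivAt_hypMetric {x : EuclideanSpace ℝ (Fin n)} (hx : x ∈ ball n)
    (v w : EuclideanSpace ℝ (Fin n)) :
    HasFDerivAt (fun y => hypMetric n y v w)
      ((16 / (1 - ‖x‖ ^ 2) ^ 3 * inner ℝ v w) • innerSL ℝ x) x := by
  have h0 := (one_sub_norm_sq_pos hx).ne'
  have h1 : ∀ d : ℝ, d ≠ 0 → HasDerivAt (fun s : ℝ => 4 / s ^ 2 * inner ℝ v w)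
      (-8 / d ^ 3 * inner ℝ v w) d := fun d hd => by
    have := ((((hasDerivAt_id d).pow 2).inv (pow_ne_zero 2 hd)).const_mul 4).mul_const
      (inner ℝ v w)
    refine (this.congr_of_eventuallyEq (Eventually.of_forall fun y => ?_)).congr_deriv ?_
    · simp [div_eq_mul_inv]
    · simp only [id, Pi.pow_apply]
      field_simp
      push_cast
      ring
  refine ((h1 _ h0).comp_hasFDerivAt x (hasFDerivAt_one_sub_norm_sq x)).congr_fderiv ?_
  ext z
  simp only [smul_apply, neg_apply, innerSL_apply_apply, smul_eq_mul, nsmul_eq_mul]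
  push_cast
  ring

/-- With both slots equal to v, the first and third Christoffel terms cancel, and only the
derivative of the metric along X survives. -/
theorem covInner_hypMetric_self {x : EuclideanSpace ℝ (Fin n)} (hx : x ∈ ball n)
    {X : EuclideanSpace ℝ (Fin n) → EuclideanSpace ℝ (Fin n)} (v : EuclideanSpace ℝ (Fin n)) :
    covInner (hypMetric n) x v X v = hypMetric n x (fderiv ℝ X x v) v
      + 8 / (1 - ‖x‖ ^ 2) ^ 3 * inner ℝ x (X x) * inner ℝ v v := by
  rw [covInner, (hasFDerivAt_hypMetric hx _ _).fderiv, (hasFDerivAt_hypMetric hx _ _).fderiv,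
    (hasFDerivAt_hypMetric hx _ _).fderiv]
  simp only [smul_apply, innerSL_apply_apply, smul_eq_mul, real_inner_comm v (X x)]
  ring

theorem hasFDerivAt_conformalField (e x : EuclideanSpace ℝ (Fin n)) :
    HasFDerivAt (conformalField e) ((-(innerSL ℝ x)).smulRight e +
      (inner ℝ x e • ContinuousLinearMap.id ℝ _ + (innerSL ℝ e).smulRight x)) x := by
  have h1 : HasFDerivAt (fun y : EuclideanSpace ℝ (Fin n) => (1 - ‖y‖ ^ 2) / 2)
      (-(innerSL ℝ x)) x := by
    have := (hasFDerivAt_one_sub_norm_sq x).mul_const (1 / 2 : ℝ)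
    refine (this.congr_of_eventuallyEq (Eventually.of_forall fun y => by ring)).congr_fderiv ?_
    ext z
    simp
  have h2 : HasFDerivAt (fun y : EuclideanSpace ℝ (Fin n) => inner ℝ y e) (innerSL ℝ e) x :=
    ((innerSL ℝ e).hasFDerivAt (x := x)).congr_of_eventuallyEq
      (Eventually.of_forall fun y => by simp [real_inner_comm])
  exact (h1.smul_const e).add (h2.smul (hasFDerivAt_id x))

/-- The covariant derivative of a multiple of the conformal field. -/
theorem covInner_smul_conformalField {e x : EuclideanSpace ℝ (Fin n)} (hx : x ∈ ball n)
    {k : EuclideanSpace ℝ (Fin n) → ℝ} {k' : EuclideanSpace ℝ (Fin n) →L[ℝ] ℝ}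
    (hk : HasFDerivAt k k' x) (v : EuclideanSpace ℝ (Fin n)) :
    covInner (hypMetric n) x v (fun y => k y • conformalField e y) v
      = k' v * hypMetric n x (conformalField e x) v
        + k x * sinhDist e x * hypMetric n x v v := by
  have h0 := (one_sub_norm_sq_pos hx).ne'
  rw [covInner_hypMetric_self hx, show fderiv ℝ (fun y => k y • conformalField e y) x = _ from
    (hk.smul (hasFDerivAt_conformalField e x)).fderiv]
  simp only [hypMetric, conformalField, sinhDist, add_apply, smul_apply,
    ContinuousLinearMap.smulRight_apply, neg_apply, innerSL_apply_apply, inner_add_left,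
    inner_add_right, real_inner_smul_left, real_inner_smul_right,
    real_inner_self_eq_norm_sq x, ContinuousLinearMap.id_apply]
  field_simp
  ring

theorem hasFDerivAt_prodMetric {p : EuclideanSpace ℝ (Fin n) × ℝ} (hp : p.1 ∈ ball n)
    (v w : EuclideanSpace ℝ (Fin n) × ℝ) :
    HasFDerivAt (fun q => prodMetric n q v w)
      ((fderiv ℝ (fun y => hypMetric n y v.1 w.1) p.1).comp
        (ContinuousLinearMap.fst ℝ (EuclideanSpace ℝ (Fin n)) ℝ)) p := by
  have h := (hasFDerivAt_hypMetric hp v.1 w.1).differentiableAt.hasFDerivAt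
  exact (h.comp p hasFDerivAt_fst).add_const (v.2 * w.2)

/-- The covariant derivative in the product of a vector field that does not depend on the
height. -/
theorem covInner_prodMetric {p : EuclideanSpace ℝ (Fin n) × ℝ} (hp : p.1 ∈ ball n)
    {X : EuclideanSpace ℝ (Fin n) → EuclideanSpace ℝ (Fin n)}
    {w : EuclideanSpace ℝ (Fin n) → ℝ} (hX : DifferentiableAt ℝ X p.1)
    (hw : DifferentiableAt ℝ w p.1) (v z : EuclideanSpace ℝ (Fin n) × ℝ) :
    covInner (prodMetric n) p v (fun q => (X q.1, w q.1)) z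
      = covInner (hypMetric n) p.1 v.1 X z.1 + fderiv ℝ w p.1 v.1 * z.2 := by
  have h : HasFDerivAt (fun q : EuclideanSpace ℝ (Fin n) × ℝ => (X q.1, w q.1))
      (((fderiv ℝ X p.1).comp (ContinuousLinearMap.fst ℝ (EuclideanSpace ℝ (Fin n)) ℝ)).prod
        ((fderiv ℝ w p.1).comp (ContinuousLinearMap.fst ℝ (EuclideanSpace ℝ (Fin n)) ℝ))) p :=
    (hX.hasFDerivAt.comp p hasFDerivAt_fst).prodMk (hw.hasFDerivAt.comp p hasFDerivAt_fst)
  rw [covInner, h.fderiv, (hasFDerivAt_prodMetric hp _ _).fderiv,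
    (hasFDerivAt_prodMetric hp _ _).fderiv, (hasFDerivAt_prodMetric hp _ _).fderiv, covInner]
  simp only [prodMetric, ContinuousLinearMap.prod_apply, ContinuousLinearMap.comp_apply,
    ContinuousLinearMap.coe_fst']
  ring

/-! ### The equidistant hypersurface -/

/-- The unit normal field of the equidistant hypersurfaces that points to `hyperplane e`. -/
def equidistantNormal (e x : EuclideanSpace ℝ (Fin n)) : EuclideanSpace ℝ (Fin n) :=
  (-(Real.cosh (hyperplaneDist e x))⁻¹) • conformalField e x

theorem contDiffOn_equidistantNormal (e : EuclideanSpace ℝ (Fin n)) :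
    ContDiffOn ℝ ∞ (equidistantNormal e) (ball n) :=
  ((Real.contDiff_cosh.comp_contDiffOn (contDiffOn_hyperplaneDist e)).inv
    fun _ _ => (Real.cosh_pos _).ne').neg.smul (contDiff_conformalField e).contDiffOn

theorem hypMetric_conformalField_eq_zero {e x : EuclideanSpace ℝ (Fin n)} (hx : x ∈ ball n)
    {v : EuclideanSpace ℝ (Fin n)} (h : fderiv ℝ (hyperplaneDist e) x v = 0) :
    hypMetric n x (conformalField e x) v = 0 := by
  rw [(hasFDerivAt_hyperplaneDist e hx).fderiv] at h
  simpa [hypMetric, (Real.cosh_pos (hyperplaneDist e x)).ne'] using h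

theorem fderiv_hyperplaneDist_apply {e x : EuclideanSpace ℝ (Fin n)} (hx : x ∈ ball n)
    (v : EuclideanSpace ℝ (Fin n)) :
    fderiv ℝ (hyperplaneDist e) x v =
      (Real.cosh (hyperplaneDist e x))⁻¹ * hypMetric n x (conformalField e x) v := by
  rw [(hasFDerivAt_hyperplaneDist e hx).fderiv]
  simp [hypMetric]

theorem fderiv_hyperplaneDist_equidistantNormal {e x : EuclideanSpace ℝ (Fin n)} (he : ‖e‖ = 1)
    (hx : x ∈ ball n) : fderiv ℝ (hyperplaneDist e) x (equidistantNormal e x) = -1 := by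
  have hc := (Real.cosh_pos (hyperplaneDist e x)).ne'
  have h := hypMetric_conformalField_self_eq_cosh he hx
  rw [equidistantNormal, map_smul, fderiv_hyperplaneDist_apply hx, h, smul_eq_mul]
  field_simp

/-- Since ∇_v Y = (sinh d) v, the hypersurface is umbilic: each tangent direction contributes sinh r
/ cosh r. -/
theorem hasConstMeanCurvature_equidistant (hn : 2 ≤ n) {e : EuclideanSpace ℝ (Fin n)}
    (he : ‖e‖ = 1) {r : ℝ} (hr : 0 < r) :
    HasConstMeanCurvature (hypMetric n) (equidistant e r) (equidistantNormal e) (Real.tanh r) := by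
  rw [equidistant_eq he hr]
  refine ⟨⟨ball n, isOpen_ball, fun x hx => hx.1, contDiffOn_equidistantNormal e⟩, ?_⟩
  rintro p ⟨hp, hpr⟩
  have hfd : fderiv ℝ (fun y => hyperplaneDist e y - r) p = fderiv ℝ (hyperplaneDist e) p :=
    fderiv_sub_const r
  have hc := (Real.cosh_pos (hyperplaneDist e p)).ne'
  refine ⟨fun y => hyperplaneDist e y - r, ⟨?_, ball n, isOpen_ball.mem_nhds hp,
    (contDiffOn_hyperplaneDist e).sub contDiffOn_const, fun x hx => ?_⟩, ?_, fun v hv => ?_, ?_⟩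
  · intro h0
    have := fderiv_hyperplaneDist_equidistantNormal he hp
    rw [hfd] at h0
    simp [h0] at this
  · simp [hx, sub_eq_zero]
  · have h := hypMetric_conformalField_self_eq_cosh he hp
    simp only [hypMetric, equidistantNormal, real_inner_smul_left, real_inner_smul_right] at h ⊢
    linear_combination (-(Real.cosh (hyperplaneDist e p))⁻¹) ^ 2 * h +
      (Real.cosh (hyperplaneDist e p) * (Real.cosh (hyperplaneDist e p))⁻¹ + 1) * mul_inv_cancel₀ hc
  · rw [hfd] at hv
    have h := hypMetric_conformalField_eq_zero hp hv
    simp only [hypMetric, equidistantNormal, real_inner_smul_left] at h ⊢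
    linear_combination (-(Real.cosh (hyperplaneDist e p))⁻¹) * h
  · intro m f hm hf hff
    have hm0 : (m : ℝ) ≠ 0 := by
      rw [finrank_euclideanSpace_fin] at hm
      exact_mod_cast (show m ≠ 0 by omega)
    -- The value of this derivative can stay implicit: it is multiplied by the product of Y with a
    -- tangent vector, which is 0.
    have hk : HasFDerivAt (fun y => -(Real.cosh (hyperplaneDist e y))⁻¹) _ p :=
      (((Real.differentiable_cosh.differentiableAt.comp p
        (hasFDerivAt_hyperplaneDist e hp).differentiableAt).inv hc).neg).hasFDerivAt
    have hterm : ∀ i, -covInner (hypMetric n) p (f i) (equidistantNormal e) (f i)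
        = Real.tanh r := fun i => by
      have hi := hypMetric_conformalField_eq_zero hp ((hfd ▸ hf i :))
      have := covInner_smul_conformalField (e := e) hp hk (f i)
      rw [hi, hff, if_pos rfl] at this
      rw [show equidistantNormal e = fun y => (-(Real.cosh (hyperplaneDist e y))⁻¹) •
        conformalField e y from rfl, this, ← sinh_hyperplaneDist, hpr, Real.tanh_eq_sinh_div_cosh]
      ring
    simp only [hterm, Finset.sum_const, Finset.card_univ, Fintype.card_fin, nsmul_eq_mul]
    field_simp

/-! ### Traces over orthonormal families -/

/-- Parseval's identity for a family of maximal size that is orthonormal for a bilinear form. -/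
theorem sum_sq_eq_of_orthonormal {E ι : Type*} [AddCommGroup E] [Module ℝ E] [Fintype ι]
    [DecidableEq ι] (B : E →ₗ[ℝ] E →ₗ[ℝ] ℝ) (b : ι → E)
    (hb : ∀ i j, B (b i) (b j) = if i = j then 1 else 0)
    (hcard : Fintype.card ι = Module.finrank ℝ E) (hpos : 0 < Fintype.card ι) (z : E) :
    ∑ i, B z (b i) ^ 2 = B z z := by
  have hli : LinearIndependent ℝ b := by
    refine Fintype.linearIndependent_iff.2 fun c hc i => ?_
    have := congrArg (fun y => B y (b i)) hc
    simpa [map_sum, LinearMap.sum_apply, hb] using this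
  have : Nonempty ι := Fintype.card_pos_iff.1 hpos
  let β := basisOfLinearIndependentOfCardEqFinrank hli hcard
  have hβ : ⇑β = b := coe_basisOfLinearIndependentOfCardEqFinrank hli hcard
  have hz : z = ∑ i, β.repr z i • b i := by
    conv_lhs => rw [← β.sum_repr z]
    rw [hβ]
  have hzi : ∀ i, B z (b i) = β.repr z i := fun i => by
    conv_lhs => rw [hz]
    simp [map_sum, LinearMap.sum_apply, hb]
  simp only [hzi]
  conv_rhs => rw [hz]
  simp [map_sum, LinearMap.sum_apply, hb, pow_two]

/-- `prodMetric` at a point, as a bilinear form. -/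
def prodMetricForm (p : EuclideanSpace ℝ (Fin n) × ℝ) :
    (EuclideanSpace ℝ (Fin n) × ℝ) →ₗ[ℝ] (EuclideanSpace ℝ (Fin n) × ℝ) →ₗ[ℝ] ℝ :=
  LinearMap.mk₂ ℝ (prodMetric n p)
    (fun v w z => by simp only [prodMetric, hypMetric, Prod.fst_add, Prod.snd_add, inner_add_left]
                     ring)
    (fun c v z => by simp only [prodMetric, hypMetric, Prod.smul_fst, Prod.smul_snd,
                       real_inner_smul_left, smul_eq_mul]
                     ring)
    (fun v w z => by simp only [prodMetric, hypMetric, Prod.fst_add, Prod.snd_add, inner_add_right]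
                     ring)
    (fun c v z => by simp only [prodMetric, hypMetric, Prod.smul_fst, Prod.smul_snd,
                       real_inner_smul_right, smul_eq_mul]
                     ring)

/-- The vertical parts of an orthonormal basis of the complement of a unit vector `N`. -/
theorem sum_snd_sq_of_orthonormal {p N : EuclideanSpace ℝ (Fin n) × ℝ} {m : ℕ}
    (hm : m + 1 = Module.finrank ℝ (EuclideanSpace ℝ (Fin n) × ℝ))
    {f : Fin m → EuclideanSpace ℝ (Fin n) × ℝ}
    (hN : prodMetric n p N N = 1) (hNf : ∀ i, prodMetric n p N (f i) = 0)
    (hf : ∀ i j, prodMetric n p (f i) (f j) = if i = j then 1 else 0) :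
    ∑ i, (f i).2 ^ 2 = 1 - N.2 ^ 2 := by
  have hsymm : ∀ v w, prodMetric n p v w = prodMetric n p w v := fun v w => by
    simp only [prodMetric, hypMetric_comm p.1 v.1 w.1, mul_comm v.2]
  -- N completes the family to an orthonormal basis, indexed by `Option (Fin m)`; Parseval is
  -- applied to the vertical unit vector (0, 1).
  have h := sum_sq_eq_of_orthonormal (prodMetricForm p) (fun o : Option (Fin m) => o.elim N f)
    (by
      rintro (_ | i) (_ | j)
      · simpa [prodMetricForm] using hN
      · simpa [prodMetricForm] using hNf j
      · simpa [prodMetricForm, hsymm] using hNf i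
      · simpa [prodMetricForm] using hf i j) (by simpa using hm) (by simp) (0, 1)
  simp only [Fintype.sum_option] at h
  simp [prodMetricForm, prodMetric, hypMetric] at h
  linarith

/-! ### The mean curvature of the translation hypersurface -/

/-- The side of an equidistant hypersurface away from `hyperplane e`. -/
def outerSide (e : EuclideanSpace ℝ (Fin n)) (r : ℝ) : Set (EuclideanSpace ℝ (Fin n)) :=
  {x | x ∈ ball n ∧ r < hyperplaneDist e x}

/-- The upward unit normal of the graph of `height k r ∘ hyperplaneDist e`. -/
def graphNormal (k : ℕ) (r : ℝ) (e : EuclideanSpace ℝ (Fin n)) (q : EuclideanSpace ℝ (Fin n) × ℝ) :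
    EuclideanSpace ℝ (Fin n) × ℝ :=
  ((-(profile k r (hyperplaneDist e q.1) / Real.cosh (hyperplaneDist e q.1))) • conformalField e q.1,
    Real.sqrt (1 - profile k r (hyperplaneDist e q.1) ^ 2))

theorem isOpen_outerSide (e : EuclideanSpace ℝ (Fin n)) (r : ℝ) : IsOpen (outerSide e r) :=
  (contDiffOn_hyperplaneDist e).continuousOn.isOpen_inter_preimage isOpen_ball isOpen_Ioi

theorem translationHypersurface_eq {e : EuclideanSpace ℝ (Fin n)} (he : ‖e‖ = 1) (r : ℝ)
    (μ : ℝ → ℝ) :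
    translationHypersurface e (Ioi r) μ = {q | q.1 ∈ outerSide e r ∧ q.2 = μ (hyperplaneDist e q.1)} := by
  ext ⟨x, t⟩
  simp only [translationHypersurface, mem_ofPred_eq, Prod.mk.injEq]
  constructor
  · rintro ⟨a, ha, ρ, hρ, rfl, rfl⟩
    rw [hyperplaneDist_hypTranslation he ha]
    exact ⟨⟨hypTranslation_mem_ball he ha ρ, by rwa [hyperplaneDist_hypTranslation he ha]⟩, rfl⟩
  · rintro ⟨hx, rfl⟩
    obtain ⟨a, ha, hxa⟩ := exists_hypTranslation_eq he hx.1
    exact ⟨a, ha, _, hx.2, hxa, rfl⟩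

theorem contDiffOn_height_hyperplaneDist {k : ℕ} {r : ℝ} (hk : 0 < k) (hr : 0 < r)
    (e : EuclideanSpace ℝ (Fin n)) :
    ContDiffOn ℝ ∞ (fun x => height k r (hyperplaneDist e x)) (outerSide e r) :=
  (contDiffOn_height hk hr).comp ((contDiffOn_hyperplaneDist e).mono fun _ hx => hx.1) fun _ hx => hx.2

theorem contDiffOn_graphNormal {k : ℕ} {r : ℝ} (hk : 0 < k) (hr : 0 < r)
    (e : EuclideanSpace ℝ (Fin n)) :
    ContDiffOn ℝ ∞ (graphNormal k r e) (Prod.fst ⁻¹' outerSide e r) := by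
  have hd : ContDiffOn ℝ ∞ (fun q : EuclideanSpace ℝ (Fin n) × ℝ => hyperplaneDist e q.1)
      (Prod.fst ⁻¹' outerSide e r) :=
    (contDiffOn_hyperplaneDist e).comp contDiff_fst.contDiffOn fun _ hx => hx.1
  have hp := (contDiff_profile k r).comp_contDiffOn hd
  refine ContDiffOn.prodMk ?_ ?_
  · exact (hp.div (Real.contDiff_cosh.comp_contDiffOn hd) fun _ _ => (Real.cosh_pos _).ne').neg.smul
      ((contDiff_conformalField e).comp contDiff_fst).contDiffOn
  · exact (contDiffOn_const.sub (hp.pow 2)).sqrt fun q hq =>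
      (one_sub_profile_sq_pos hk hr hq.2).ne'

theorem hasFDerivAt_graph {k : ℕ} {r : ℝ} (hk : 0 < k) (hr : 0 < r)
    {e : EuclideanSpace ℝ (Fin n)} {p : EuclideanSpace ℝ (Fin n) × ℝ} (hp : p.1 ∈ outerSide e r) :
    HasFDerivAt (fun q : EuclideanSpace ℝ (Fin n) × ℝ => q.2 - height k r (hyperplaneDist e q.1))
      (ContinuousLinearMap.snd ℝ (EuclideanSpace ℝ (Fin n)) ℝ -
        slope k r (hyperplaneDist e p.1) • (fderiv ℝ (hyperplaneDist e) p.1).comp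
          (ContinuousLinearMap.fst ℝ (EuclideanSpace ℝ (Fin n)) ℝ)) p := by
  have h1 : HasFDerivAt (fun q : EuclideanSpace ℝ (Fin n) × ℝ => hyperplaneDist e q.1) _ p :=
    (hasFDerivAt_hyperplaneDist e hp.1).differentiableAt.hasFDerivAt.comp p hasFDerivAt_fst
  have h2 : HasDerivAt (height k r) (slope k r (hyperplaneDist e p.1))
      ((fun q : EuclideanSpace ℝ (Fin n) × ℝ => hyperplaneDist e q.1) p) :=
    hasDerivAt_height hk hr hp.2
  have h3 := h2.comp_hasFDerivAt p h1
  exact hasFDerivAt_snd.sub h3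

/-- For a unit tangent vector, tangency determines g(Y, v.1) from v.2, and the norm condition
determines g(v.1, v.1). The second fundamental form on v is therefore affine in v.2², and its trace
needs only the sum of the v.2². -/
theorem covInner_graphNormal {k : ℕ} {r : ℝ} (hk : 0 < k) (hr : 0 < r)
    {e : EuclideanSpace ℝ (Fin n)} {p : EuclideanSpace ℝ (Fin n) × ℝ} (hp : p.1 ∈ outerSide e r)
    {ρ φ φ' w : ℝ} (hρ : ρ = hyperplaneDist e p.1) (hφ : φ = profile k r ρ)
    (hφ' : φ' = k * Real.tanh r - k * Real.tanh ρ * φ) (hw : w = Real.sqrt (1 - φ ^ 2))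
    {v : EuclideanSpace ℝ (Fin n) × ℝ}
    (hv : v.2 = φ / w * ((Real.cosh ρ)⁻¹ * hypMetric n p.1 (conformalField e p.1) v.1))
    (hvv : prodMetric n p v v = 1) :
    covInner (prodMetric n) p v (graphNormal k r e) v =
      v.2 ^ 2 * (-(φ' - φ * Real.tanh ρ) * w ^ 2 / φ ^ 2 + φ * Real.tanh ρ - φ')
        - φ * Real.tanh ρ := by
  have hφ0 : φ ≠ 0 := by rw [hφ, hρ]; exact (profile_pos hr hp.2.le).ne'
  have hw0 : 0 < 1 - φ ^ 2 := by rw [hφ, hρ]; exact one_sub_profile_sq_pos hk hr hp.2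
  have hw1 : w ≠ 0 := by rw [hw]; exact (Real.sqrt_pos.2 hw0).ne'
  have hc := (Real.cosh_pos ρ).ne'
  have hd := (hasFDerivAt_hyperplaneDist e hp.1).differentiableAt.hasFDerivAt
  have hP : HasDerivAt (profile k r) φ' (hyperplaneDist e p.1) := by
    rw [hφ', hφ, hρ]; exact hasDerivAt_profile k r _
  have hK : HasDerivAt (fun ρ => -(profile k r ρ / Real.cosh ρ))
      (-((φ' * Real.cosh ρ - φ * Real.sinh ρ) / Real.cosh ρ ^ 2)) (hyperplaneDist e p.1) := by
    rw [hφ, hρ]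
    exact (hP.div (Real.hasDerivAt_cosh _) (by rw [← hρ]; exact hc)).neg
  have hW : HasDerivAt (fun ρ => Real.sqrt (1 - profile k r ρ ^ 2)) (-(φ * φ') / w)
      (hyperplaneDist e p.1) := by
    refine (((hP.pow 2).const_sub 1).sqrt ?_).congr_deriv ?_
    · rw [Pi.pow_apply, ← hρ, ← hφ]; exact hw0.ne'
    · rw [Pi.pow_apply, ← hρ, ← hφ, ← hw]
      field_simp
      push_cast
      ring
  have hK' := hK.comp_hasFDerivAt p.1 hd
  have hW' := hW.comp_hasFDerivAt p.1 hd
  have h1 := covInner_prodMetric hp.1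
    (hK'.differentiableAt.smul (hasFDerivAt_conformalField e p.1).differentiableAt)
    hW'.differentiableAt v v
  have h2 := covInner_smul_conformalField (e := e) hp.1 hK' v.1
  have h3 : hypMetric n p.1 v.1 v.1 = 1 - v.2 ^ 2 := by
    rw [prodMetric] at hvv; linear_combination hvv
  have hy : hypMetric n p.1 (conformalField e p.1) v.1 = v.2 * w * Real.cosh ρ / φ := by
    rw [hv]; field_simp
  rw [show graphNormal k r e = fun q => (((fun ρ => -(profile k r ρ / Real.cosh ρ)) ∘
    hyperplaneDist e) q.1 • conformalField e q.1, ((fun ρ => Real.sqrt (1 - profile k r ρ ^ 2)) ∘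
    hyperplaneDist e) q.1) from rfl]
  refine h1.trans ?_
  rw [hW'.fderiv]
  refine (congrArg (· + _) h2).trans ?_
  simp only [smul_apply, smul_eq_mul, fderiv_hyperplaneDist_apply hp.1, Function.comp_apply, h3, hy,
    ← sinh_hyperplaneDist, ← hρ, ← hφ, Real.tanh_eq_sinh_div_cosh]
  field_simp
  ring

/-- The squared vertical parts sum to 1 - w² = φ², so the trace collapses to φ' + k tanh ρ φ, which
the equation for `profile` makes equal to k tanh r. -/
theorem hasConstMeanCurvature_graph {k : ℕ} (hk : 0 < k) (hnk : n = k + 1) {r : ℝ} (hr : 0 < r)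
    {e : EuclideanSpace ℝ (Fin n)} (he : ‖e‖ = 1) :
    HasConstMeanCurvature (prodMetric n)
      {q | q.1 ∈ outerSide e r ∧ q.2 = height k r (hyperplaneDist e q.1)} (graphNormal k r e)
      (k * Real.tanh r / n) := by
  have hopen : IsOpen (Prod.fst ⁻¹' outerSide e r : Set (EuclideanSpace ℝ (Fin n) × ℝ)) :=
    (isOpen_outerSide e r).preimage continuous_fst
  refine ⟨⟨_, hopen, fun q hq => hq.1, contDiffOn_graphNormal hk hr e⟩, ?_⟩
  rintro p ⟨hp, -⟩
  have hF := hasFDerivAt_graph hk hr hp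
  obtain ⟨ρ, hρ⟩ : ∃ ρ, ρ = hyperplaneDist e p.1 := ⟨_, rfl⟩
  obtain ⟨φ, hφ⟩ : ∃ φ, φ = profile k r ρ := ⟨_, rfl⟩
  obtain ⟨w, hw⟩ : ∃ w, w = Real.sqrt (1 - φ ^ 2) := ⟨_, rfl⟩
  have hφ0 : φ ≠ 0 := by rw [hφ, hρ]; exact (profile_pos hr hp.2.le).ne'
  have hw0 : 0 < 1 - φ ^ 2 := by rw [hφ, hρ]; exact one_sub_profile_sq_pos hk hr hp.2
  have hw1 : w ≠ 0 := by rw [hw]; exact (Real.sqrt_pos.2 hw0).ne'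
  have hw2 : w ^ 2 = 1 - φ ^ 2 := by rw [hw, Real.sq_sqrt hw0.le]
  have hc := (Real.cosh_pos ρ).ne'
  have hN : graphNormal k r e p = ((-(φ / Real.cosh ρ)) • conformalField e p.1, w) := by
    rw [graphNormal, ← hρ, ← hφ, ← hw]
  have hYY := hypMetric_conformalField_self_eq_cosh he hp.1
  rw [← hρ] at hYY
  have hNN : prodMetric n p (graphNormal k r e p) (graphNormal k r e p) = 1 := by
    have h : prodMetric n p (graphNormal k r e p) (graphNormal k r e p) = (φ / Real.cosh ρ) ^ 2 *
        hypMetric n p.1 (conformalField e p.1) (conformalField e p.1) + w ^ 2 := by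
      rw [hN, prodMetric]
      simp only [hypMetric, real_inner_smul_left, real_inner_smul_right]
      ring
    rw [h, hYY, hw2]
    field_simp
    ring
  have hker : ∀ v : EuclideanSpace ℝ (Fin n) × ℝ,
      fderiv ℝ (fun q : EuclideanSpace ℝ (Fin n) × ℝ => q.2 - height k r (hyperplaneDist e q.1)) p v = 0
      → v.2 = φ / w * ((Real.cosh ρ)⁻¹ * hypMetric n p.1 (conformalField e p.1) v.1) := by
    intro v hv
    rw [hF.fderiv] at hv
    simp only [sub_apply, smul_apply, smul_eq_mul, ContinuousLinearMap.comp_apply,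
      ContinuousLinearMap.coe_snd', ContinuousLinearMap.coe_fst', fderiv_hyperplaneDist_apply hp.1,
      slope, ← hρ, ← hφ, ← hw] at hv
    linarith
  have hNv : ∀ v : EuclideanSpace ℝ (Fin n) × ℝ,
      fderiv ℝ (fun q : EuclideanSpace ℝ (Fin n) × ℝ => q.2 - height k r (hyperplaneDist e q.1)) p v = 0
      → prodMetric n p (graphNormal k r e p) v = 0 := by
    intro v hv
    have h : prodMetric n p (graphNormal k r e p) v = -(φ / Real.cosh ρ) *
        hypMetric n p.1 (conformalField e p.1) v.1 + w * v.2 := by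
      rw [hN, prodMetric]
      simp only [hypMetric, real_inner_smul_left]
      ring
    rw [h, hker v hv]
    field_simp
    ring
  refine ⟨fun q => q.2 - height k r (hyperplaneDist e q.1), ⟨?_, _, hopen.mem_nhds hp, contDiff_snd.contDiffOn.sub
    ((contDiffOn_height_hyperplaneDist hk hr e).comp contDiff_fst.contDiffOn fun _ hq => hq),
    fun q hq => ?_⟩, hNN, hNv, ?_⟩
  · intro h0
    have h1 := DFunLike.congr_fun h0 ((0, 1) : EuclideanSpace ℝ (Fin n) × ℝ)
    rw [hF.fderiv] at h1
    simp at h1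
  · exact ⟨fun h => sub_eq_zero.2 h.2, fun h => ⟨hq, sub_eq_zero.1 h⟩⟩
  · intro m f hm hf hff
    have hm' : m = n := by
      rw [Module.finrank_prod, finrank_euclideanSpace_fin, Module.finrank_self] at hm
      omega
    have hsum := sum_snd_sq_of_orthonormal hm hNN (fun i => hNv _ (hf i)) hff
    rw [hN] at hsum
    have hterm := fun i => covInner_graphNormal hk hr hp hρ hφ rfl hw (hker _ (hf i))
      ((hff i i).trans (if_pos rfl))
    have hnk' : (n : ℝ) = k + 1 := by exact_mod_cast hnk
    have hn0 : (n : ℝ) ≠ 0 := by rw [hnk']; positivity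
    simp only [hterm, Finset.sum_neg_distrib, Finset.sum_sub_distrib, ← Finset.sum_mul, hsum, hw2,
      Finset.sum_const, Finset.card_univ, Fintype.card_fin, nsmul_eq_mul, hm', hnk']
    rw [hnk'] at hn0
    field_simp
    ring

/-! ### Completeness of vertical graphs -/

theorem norm_sq_le_hypMetric {x : EuclideanSpace ℝ (Fin n)} (hx : x ∈ ball n)
    (v : EuclideanSpace ℝ (Fin n)) : ‖v‖ ^ 2 ≤ hypMetric n x v v := by
  have h0 := one_sub_norm_sq_pos hx
  rw [hypMetric_self]
  refine pow_le_pow_left₀ (norm_nonneg v) ((le_div_iff₀ h0).2 ?_) 2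
  nlinarith [norm_nonneg v, mul_nonneg (norm_nonneg v) (sq_nonneg ‖x‖)]

theorem hypMetric_self_nonneg (x v : EuclideanSpace ℝ (Fin n)) : 0 ≤ hypMetric n x v v := by
  rw [hypMetric_self]; positivity

theorem norm_le_sqrt_prodMetric {p : EuclideanSpace ℝ (Fin n) × ℝ} (hp : p.1 ∈ ball n)
    (v : EuclideanSpace ℝ (Fin n) × ℝ) : ‖v‖ ≤ Real.sqrt (prodMetric n p v v) := by
  have h := norm_sq_le_hypMetric hp v.1
  rw [Prod.norm_def]
  refine max_le ?_ ?_ <;> refine Real.le_sqrt_of_sq_le ?_ <;> rw [prodMetric]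
  · nlinarith [mul_self_nonneg v.2]
  · rw [Real.norm_eq_abs, sq_abs]
    nlinarith [hypMetric_self_nonneg p.1 v.1]

/-- The derivative is at most 2|v| / (1 - |x|²), the hyperbolic length. This keeps intrinsic Cauchy
sequences away from the ideal boundary. -/
theorem norm_fderiv_log_le {p : EuclideanSpace ℝ (Fin n) × ℝ} (hp : p.1 ∈ ball n)
    (v : EuclideanSpace ℝ (Fin n) × ℝ) :
    ‖fderiv ℝ (fun q : EuclideanSpace ℝ (Fin n) × ℝ => Real.log (1 - ‖q.1‖ ^ 2)) p v‖
      ≤ Real.sqrt (prodMetric n p v v) := by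
  have h0 := one_sub_norm_sq_pos hp
  have h1 : HasFDerivAt (fun q : EuclideanSpace ℝ (Fin n) × ℝ => 1 - ‖q.1‖ ^ 2) _ p :=
    (hasFDerivAt_one_sub_norm_sq p.1).comp p hasFDerivAt_fst
  rw [(h1.log h0.ne').fderiv]
  simp only [smul_apply, ContinuousLinearMap.comp_apply, neg_apply, innerSL_apply_apply,
    ContinuousLinearMap.coe_fst', smul_eq_mul, nsmul_eq_mul]
  refine Real.le_sqrt_of_sq_le ?_
  have h2 : prodMetric n p v v = (2 * ‖v.1‖ / (1 - ‖p.1‖ ^ 2)) ^ 2 + v.2 * v.2 := by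
    rw [prodMetric, hypMetric_self]
  have h3 := abs_real_inner_le_norm p.1 v.1
  have h4 : ‖p.1‖ * ‖v.1‖ ≤ ‖v.1‖ := mul_le_of_le_one_left (norm_nonneg _) (le_of_lt hp)
  have h5 : ‖(1 - ‖p.1‖ ^ 2)⁻¹ * -((2 : ℕ) * inner ℝ p.1 v.1)‖ ≤ 2 * ‖v.1‖ / (1 - ‖p.1‖ ^ 2) := by
    rw [norm_mul, norm_inv, norm_neg, norm_mul, Real.norm_of_nonneg h0.le, inv_mul_eq_div,
      Real.norm_eq_abs (inner ℝ _ _)]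
    refine div_le_div_of_nonneg_right ?_ h0.le
    simp
    linarith
  rw [h2]
  nlinarith [pow_le_pow_left₀ (norm_nonneg _) h5 2, mul_self_nonneg v.2]

/-- Along a smooth graph, intrinsic distances to a point are locally at most a multiple of the
distances of the projections. -/
theorem exists_intrinsicEDist_graph_le {Ω : Set (EuclideanSpace ℝ (Fin n))} (hΩ : IsOpen Ω)
    (hΩb : Ω ⊆ ball n) {u : EuclideanSpace ℝ (Fin n) → ℝ} (hu : ContDiffOn ℝ ∞ u Ω)
    {y : EuclideanSpace ℝ (Fin n)} (hy : y ∈ Ω) :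
    ∃ M : ℝ, ∀ᶠ x in 𝓝 y, intrinsicEDist (prodMetric n) {q | q.1 ∈ Ω ∧ q.2 = u q.1} (x, u x) (y, u y)
      ≤ ENNReal.ofReal (M * ‖x - y‖) := by
  set A := 4 / (1 - ‖y‖ ^ 2) ^ 2 + 1 with hA
  set B := ‖fderiv ℝ u y‖ + 1 with hB
  have hA0 : 0 ≤ A := by positivity
  have hcA : ContinuousAt (fun z : EuclideanSpace ℝ (Fin n) => 4 / (1 - ‖z‖ ^ 2) ^ 2) y := by
    refine ContinuousAt.div (by fun_prop) (by fun_prop) ?_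
    exact pow_ne_zero 2 (one_sub_norm_sq_pos (hΩb hy)).ne'
  have hcB : ContinuousAt (fun z => ‖fderiv ℝ u z‖) y :=
    ((hu.continuousOn_fderiv_of_isOpen hΩ (by exact_mod_cast le_top)).continuousAt
      (hΩ.mem_nhds hy)).norm
  have hev : ∀ᶠ z in 𝓝 y, z ∈ Ω ∧ 4 / (1 - ‖z‖ ^ 2) ^ 2 < A ∧ ‖fderiv ℝ u z‖ < B :=
    (hΩ.eventually_mem hy).and ((hcA.eventually_lt_const (lt_add_one _)).and
      (hcB.eventually_lt_const (lt_add_one _)))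
  obtain ⟨ε, hε, hball⟩ := Metric.eventually_nhds_iff_ball.1 hev
  -- The 2 bounds the parameter speed π/2 of the cosine path used below.
  refine ⟨2 * Real.sqrt (A + B ^ 2), ?_⟩
  filter_upwards [Metric.ball_mem_nhds y hε] with x hx
  have hxy : ‖x - y‖ < ε := by rwa [Metric.mem_ball, dist_eq_norm] at hx
  -- Competing curves must be C¹ on all of ℝ, while u is smooth only on Ω. Parametrizing the segment
  -- by a cosine keeps it in the small ball for every real s.
  set σ : ℝ → ℝ := fun s => Real.cos (Real.pi / 2 * s) with hσ
  set c : ℝ → EuclideanSpace ℝ (Fin n) := fun s => y + σ s • (x - y) with hc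
  have hσ' : ∀ s, HasDerivAt σ (-Real.sin (Real.pi / 2 * s) * (Real.pi / 2)) s := fun s => by
    have := (Real.hasDerivAt_cos (Real.pi / 2 * s)).comp s ((hasDerivAt_id s).const_mul (Real.pi / 2))
    rwa [mul_one] at this
  have hmem : ∀ s, c s ∈ Metric.ball y ε := fun s => by
    rw [Metric.mem_ball, dist_eq_norm, hc, add_sub_cancel_left, norm_smul, Real.norm_eq_abs]
    exact (mul_le_of_le_one_left (norm_nonneg _) (Real.abs_cos_le_one _)).trans_lt hxy
  have hcd : ContDiff ℝ ∞ c :=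
    contDiff_const.add ((Real.contDiff_cos.comp (contDiff_const.mul contDiff_id)).smul
      contDiff_const)
  have hucd : ContDiff ℝ ∞ fun s => u (c s) :=
    hu.comp_contDiff hcd fun s => (hball _ (hmem s)).1
  have hderiv : ∀ s, HasDerivAt (fun s => (c s, u (c s)))
      ((-Real.sin (Real.pi / 2 * s) * (Real.pi / 2)) •
        (x - y, fderiv ℝ u (c s) (x - y))) s := fun s => by
    have h1 : HasDerivAt c ((-Real.sin (Real.pi / 2 * s) * (Real.pi / 2)) • (x - y)) s :=
      ((hσ' s).smul_const (x - y)).const_add y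
    have h2 := ((hu.differentiableOn (by simp)).differentiableAt
      (hΩ.mem_nhds (hball _ (hmem s)).1)).hasFDerivAt.comp_hasDerivAt s h1
    rw [map_smul] at h2
    exact h1.prodMk h2
  refine (intrinsicEDist_le (c := fun s => (c s, u (c s)))
    ((hcd.prodMk hucd).of_le (by exact_mod_cast le_top)) ?_ ?_ ?_).trans ?_
  · simp [hc, hσ]
  · simp [hc, hσ]
  · exact fun s _ => ⟨(hball _ (hmem s)).1, rfl⟩
  refine ENNReal.ofReal_le_ofReal ((le_abs_self _).trans ?_)
  rw [curveLength, ← Real.norm_eq_abs]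
  have := intervalIntegral.norm_integral_le_of_norm_le_const (a := 0) (b := 1)
    (C := 2 * Real.sqrt (A + B ^ 2) * ‖x - y‖)
    (f := fun s => Real.sqrt (prodMetric n (c s, u (c s)) (deriv (fun s => (c s, u (c s))) s)
      (deriv (fun s => (c s, u (c s))) s))) fun s _ => ?_
  · simpa using this
  rw [(hderiv s).deriv, Real.norm_of_nonneg (Real.sqrt_nonneg _)]
  refine Real.sqrt_le_iff.2 ⟨by positivity, ?_⟩
  obtain ⟨-, hAs, hBs⟩ := hball _ (hmem s)
  obtain ⟨b, hb⟩ : ∃ b, b = -Real.sin (Real.pi / 2 * s) * (Real.pi / 2) := ⟨_, rfl⟩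
  have hb2 : b ^ 2 ≤ 2 ^ 2 := by
    rw [hb, mul_pow, neg_sq]
    have h1 := Real.sin_sq_le_one (Real.pi / 2 * s)
    have h2 : (Real.pi / 2) ^ 2 ≤ 2 ^ 2 :=
      pow_le_pow_left₀ (by positivity) (by linarith [Real.pi_le_four]) 2
    nlinarith [sq_nonneg (Real.pi / 2)]
  have hd : (fderiv ℝ u (c s) (x - y)) ^ 2 ≤ B ^ 2 * ‖x - y‖ ^ 2 := by
    rw [← mul_pow, ← sq_abs, ← Real.norm_eq_abs]
    exact pow_le_pow_left₀ (norm_nonneg _) ((ContinuousLinearMap.le_opNorm _ _).trans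
      (mul_le_mul_of_nonneg_right hBs.le (norm_nonneg _))) 2
  have hg : prodMetric n (c s, u (c s)) (b • (x - y, fderiv ℝ u (c s) (x - y)))
      (b • (x - y, fderiv ℝ u (c s) (x - y))) = b ^ 2 * (4 / (1 - ‖c s‖ ^ 2) ^ 2 * ‖x - y‖ ^ 2 +
        fderiv ℝ u (c s) (x - y) ^ 2) := by
    simp only [prodMetric, hypMetric, Prod.smul_fst, Prod.smul_snd, real_inner_self_eq_norm_sq,
      norm_smul, mul_pow, Real.norm_eq_abs, sq_abs, smul_eq_mul]
    ring
  rw [← hb, hg, mul_pow, mul_pow, Real.sq_sqrt (by positivity), mul_assoc]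
  have h1 : 4 / (1 - ‖c s‖ ^ 2) ^ 2 * ‖x - y‖ ^ 2 ≤ A * ‖x - y‖ ^ 2 :=
    mul_le_mul_of_nonneg_right hAs.le (sq_nonneg _)
  exact mul_le_mul hb2 (by linarith) (by positivity) (by positivity)

/-- A vertical graph that is unbounded below at the boundary points of its domain in hyperbolic
space is complete. -/
theorem isRiemannianComplete_graph {Ω : Set (EuclideanSpace ℝ (Fin n))} (hΩ : IsOpen Ω)
    (hΩb : Ω ⊆ ball n) {u : EuclideanSpace ℝ (Fin n) → ℝ} (hu : ContDiffOn ℝ ∞ u Ω)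
    (hbd : ∀ y ∈ closure Ω, y ∈ ball n → y ∉ Ω → Tendsto u (𝓝[Ω] y) atBot) :
    IsRiemannianComplete (prodMetric n) {q | q.1 ∈ Ω ∧ q.2 = u q.1} := by
  intro x hx hcauchy
  set S : Set (EuclideanSpace ℝ (Fin n) × ℝ) := {q | q.1 ∈ Ω ∧ q.2 = u q.1} with hS
  have hU : IsOpen (Prod.fst ⁻¹' ball n : Set (EuclideanSpace ℝ (Fin n) × ℝ)) :=
    isOpen_ball.preimage continuous_fst
  have hSU : S ⊆ Prod.fst ⁻¹' ball n := fun q hq => hΩb hq.1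
  have hnorm : ∀ p q, ENNReal.ofReal ‖q - p‖ ≤ intrinsicEDist (prodMetric n) S p q :=
    ofReal_norm_sub_le_intrinsicEDist hU hSU continuousOn_prodMetric contDiff_id.contDiffOn
      fun p hp v => by simpa using norm_le_sqrt_prodMetric hp v
  have hlog := ofReal_norm_sub_le_intrinsicEDist hU hSU continuousOn_prodMetric
    (F := fun q : EuclideanSpace ℝ (Fin n) × ℝ => Real.log (1 - ‖q.1‖ ^ 2))
    (ContDiffOn.log (contDiff_const.sub ((contDiff_norm_sq ℝ).comp contDiff_fst)).contDiffOn
      fun q hq => (one_sub_norm_sq_pos hq).ne') fun p hp v => norm_fderiv_log_le hp v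
  have hcs : CauchySeq x := by
    refine Metric.cauchySeq_iff.2 fun ε hε => ?_
    obtain ⟨K, hK⟩ := hcauchy (ENNReal.ofReal ε) (ENNReal.ofReal_pos.2 hε)
    refine ⟨K, fun i hi j hj => ?_⟩
    rw [dist_eq_norm]
    exact (ENNReal.ofReal_lt_ofReal_iff hε).1 ((hnorm _ _).trans_lt (hK j hj i hi))
  obtain ⟨q, hq⟩ := cauchySeq_tendsto_of_complete hcs
  have hq1 : Tendsto (fun i => (x i).1) atTop (𝓝 q.1) := (continuous_fst.tendsto q).comp hq
  have hq2 : Tendsto (fun i => u (x i).1) atTop (𝓝 q.2) :=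
    ((continuous_snd.tendsto q).comp hq).congr fun i => (hx i).2
  have hq1Ω : Tendsto (fun i => (x i).1) atTop (𝓝[Ω] q.1) :=
    tendsto_nhdsWithin_iff.2 ⟨hq1, Eventually.of_forall fun i => (hx i).1⟩
  -- From index K on, log (1 - |x|²) drops by at most 1, which bounds 1 - |x|² below by a positive
  -- constant.
  have hqb : q.1 ∈ ball n := by
    obtain ⟨K, hK⟩ := hcauchy 1 one_pos
    have hlow : ∀ i ≥ K, Real.exp (Real.log (1 - ‖(x K).1‖ ^ 2) - 1) ≤ 1 - ‖(x i).1‖ ^ 2 := by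
      intro i hi
      have h1 := (hlog (x K) (x i)).trans_lt (hK K le_rfl i hi)
      rw [← ENNReal.ofReal_one, ENNReal.ofReal_lt_ofReal_iff one_pos, Real.norm_eq_abs] at h1
      rw [← Real.le_log_iff_exp_le (one_sub_norm_sq_pos (hΩb (hx i).1))]
      linarith [(abs_lt.1 h1).1]
    have hlim : Tendsto (fun i => 1 - ‖(x i).1‖ ^ 2) atTop (𝓝 (1 - ‖q.1‖ ^ 2)) :=
      (hq1.norm.pow 2).const_sub 1
    have hle := ge_of_tendsto hlim (eventually_atTop.2 ⟨K, hlow⟩)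
    have := (Real.exp_pos _).trans_le hle
    exact (sq_lt_one_iff₀ (norm_nonneg _)).1 (by linarith)
  have hqΩ : q.1 ∈ Ω := by
    by_contra hcon
    have hcl : q.1 ∈ closure Ω := mem_closure_of_tendsto hq1 (Eventually.of_forall fun i => (hx i).1)
    exact not_tendsto_nhds_of_tendsto_atBot ((hbd _ hcl hqb hcon).comp hq1Ω) _ hq2
  have hqu : q.2 = u q.1 := tendsto_nhds_unique hq2
    (((hu.continuousOn.continuousAt (hΩ.mem_nhds hqΩ)).tendsto).comp hq1)
  refine ⟨q, ⟨hqΩ, hqu⟩, ?_⟩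
  obtain ⟨M, hM⟩ := exists_intrinsicEDist_graph_le hΩ hΩb hu hqΩ
  have hlim : Tendsto (fun i => ENNReal.ofReal (M * ‖(x i).1 - q.1‖)) atTop (𝓝 0) := by
    have h1 : Tendsto (fun i => M * ‖(x i).1 - q.1‖) atTop (𝓝 (M * ‖q.1 - q.1‖)) :=
      ((hq1.sub_const q.1).norm).const_mul M
    have h2 := ENNReal.tendsto_ofReal h1
    simpa using h2
  refine tendsto_of_tendsto_of_tendsto_of_le_of_le' tendsto_const_nhds hlim
    (Eventually.of_forall fun _ => zero_le) ?_
  filter_upwards [hq1.eventually hM] with i hi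
  have h1 : x i = ((x i).1, u (x i).1) := Prod.ext rfl (hx i).2
  have h2 : q = (q.1, u q.1) := Prod.ext rfl hqu
  rw [h1, h2]
  exact hi

/-! ### The sides of an equidistant hypersurface -/

theorem continuousOn_hypTranslation {e : EuclideanSpace ℝ (Fin n)} (he : ‖e‖ = 1) :
    ContinuousOn (fun q : EuclideanSpace ℝ (Fin n) × ℝ =>
      hypTranslation q.1 (Real.tanh (q.2 / 2) • e)) (hyperplane e ×ˢ univ) := by
  have ht : Continuous Real.tanh := (contDiff_tanh (m := 0)).continuous
  have h1 : Continuous fun q : EuclideanSpace ℝ (Fin n) × ℝ =>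
      1 + ‖q.1‖ ^ 2 * Real.tanh (q.2 / 2) ^ 2 := by fun_prop
  have h2 : Continuous fun q : EuclideanSpace ℝ (Fin n) × ℝ =>
      (1 + Real.tanh (q.2 / 2) ^ 2) • q.1 + ((1 - ‖q.1‖ ^ 2) * Real.tanh (q.2 / 2)) • e := by
    fun_prop
  refine (((h1.inv₀ fun q => by positivity).smul h2).continuousOn).congr fun q hq => ?_
  exact hypTranslation_of_inner_eq_zero he hq.1.2 _

theorem convex_hyperplane (e : EuclideanSpace ℝ (Fin n)) : Convex ℝ (hyperplane e) := by
  have h1 : Convex ℝ (ball n) := by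
    have : ball n = Metric.ball (0 : EuclideanSpace ℝ (Fin n)) 1 := by
      ext x; simp [ball]
    rw [this]
    exact convex_ball 0 1
  exact h1.inter (_root_.convex_hyperplane
    (f := fun x : EuclideanSpace ℝ (Fin n) => inner ℝ x e)
    ⟨fun x y => inner_add_left x y e, fun c x => real_inner_smul_left x e c⟩ 0)

/-- In the coordinates (foot of the perpendicular, signed distance) this set is the product of the
convex hyperplane with J. -/
theorem isPreconnected_hyperplaneDist_preimage {e : EuclideanSpace ℝ (Fin n)} (he : ‖e‖ = 1)
    {J : Set ℝ} (hJ : IsPreconnected J) : IsPreconnected {x | x ∈ ball n ∧ hyperplaneDist e x ∈ J} := by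
  have h : {x | x ∈ ball n ∧ hyperplaneDist e x ∈ J} =
      (fun q : EuclideanSpace ℝ (Fin n) × ℝ => hypTranslation q.1 (Real.tanh (q.2 / 2) • e)) ''
        (hyperplane e ×ˢ J) := by
    ext x
    constructor
    · rintro ⟨hx, hxJ⟩
      obtain ⟨a, ha, hxa⟩ := exists_hypTranslation_eq he hx
      exact ⟨(a, hyperplaneDist e x), ⟨ha, hxJ⟩, hxa.symm⟩
    · rintro ⟨⟨a, ρ⟩, ⟨ha, hρ⟩, rfl⟩
      exact ⟨hypTranslation_mem_ball he ha ρ, by rwa [hyperplaneDist_hypTranslation he ha]⟩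
  rw [h]
  exact ((convex_hyperplane e).isPreconnected.prod hJ).image _
    ((continuousOn_hypTranslation he).mono (prod_mono_right (subset_univ J)))

theorem zero_mem_hyperplane (e : EuclideanSpace ℝ (Fin n)) : 0 ∈ hyperplane e := by
  simp [hyperplane, ball]

/-- One of two disjoint open preconnected sets is a component of their union. -/
theorem isComponent_of_union {E : Type*} [NormedAddCommGroup E]
    {A D D' : Set E} (hD : IsOpen D) (hD' : IsOpen D') (hpre : IsPreconnected D)
    (hne : D.Nonempty) (hdisj : Disjoint D D') (hA : D ∪ D' = A) : IsComponent A D := by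
  obtain ⟨x, hx⟩ := hne
  have hxA : x ∈ A := hA ▸ Or.inl hx
  refine ⟨x, hxA, Subset.antisymm
    (hpre.subset_connectedComponentIn hx (hA ▸ subset_union_left)) ?_⟩
  refine isPreconnected_connectedComponentIn.subset_left_of_subset_union hD hD' hdisj ?_
    ⟨x, mem_connectedComponentIn hxA, hx⟩
  rw [hA]
  exact connectedComponentIn_subset A x

theorem isSideOppositeTo_outerSide {e : EuclideanSpace ℝ (Fin n)} (he : ‖e‖ = 1) {r : ℝ}
    (hr : 0 < r) : IsSideOppositeTo (equidistant e r) (equidistantNormal e) (outerSide e r) := by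
  set D : Set (EuclideanSpace ℝ (Fin n)) := {x | x ∈ ball n ∧ hyperplaneDist e x ∈ Iio r} with hDdef
  have hD : IsOpen D :=
    (contDiffOn_hyperplaneDist e).continuousOn.isOpen_inter_preimage isOpen_ball isOpen_Iio
  have hΩ := isOpen_outerSide e r
  have hmem : ∀ ρ, hypTranslation 0 (Real.tanh (ρ / 2) • e) ∈ ball n ∧
      hyperplaneDist e (hypTranslation 0 (Real.tanh (ρ / 2) • e)) = ρ := fun ρ =>
    ⟨hypTranslation_mem_ball he (zero_mem_hyperplane e) ρ,
      hyperplaneDist_hypTranslation he (zero_mem_hyperplane e) ρ⟩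
  have hDne : D.Nonempty := ⟨_, (hmem 0).1, by rw [(hmem 0).2]; exact hr⟩
  have hΩne : (outerSide e r).Nonempty :=
    ⟨_, (hmem (r + 1)).1, by rw [(hmem (r + 1)).2]; exact lt_add_one r⟩
  have hdisj : Disjoint D (outerSide e r) :=
    Set.disjoint_left.2 fun x hx hx' => lt_asymm hx.2 hx'.2
  have hA : D ∪ outerSide e r = ball n \ equidistant e r := by
    rw [equidistant_eq he hr]
    ext x
    constructor
    · rintro (⟨hx, h⟩ | ⟨hx, h⟩)
      · exact ⟨hx, fun h' => (mem_Iio.1 h).ne h'.2⟩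
      · exact ⟨hx, fun h' => h.ne' h'.2⟩
    · rintro ⟨hx, h⟩
      rcases lt_trichotomy (hyperplaneDist e x) r with h' | h' | h'
      · exact Or.inl ⟨hx, h'⟩
      · exact absurd ⟨hx, h'⟩ h
      · exact Or.inr ⟨hx, h'⟩
  refine ⟨D, isComponent_of_union hD hΩ (isPreconnected_hyperplaneDist_preimage he isPreconnected_Iio)
    hDne hdisj hA, isComponent_of_union hΩ hD
    (isPreconnected_hyperplaneDist_preimage he isPreconnected_Ioi) hΩne hdisj.symm
    (by rw [union_comm, hA]), ?_, hA, ?_⟩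
  · intro h
    obtain ⟨x, hx⟩ := hDne
    exact Set.disjoint_left.1 hdisj hx (h ▸ hx)
  · rw [equidistant_eq he hr]
    rintro p ⟨hp, hpr⟩
    have hline : HasDerivAt (fun s : ℝ => p + s • equidistantNormal e p) (equidistantNormal e p)
        0 := by
      simpa using ((hasDerivAt_id (0 : ℝ)).smul_const (equidistantNormal e p)).const_add p
    have hp0 : p + (0 : ℝ) • equidistantNormal e p = p := by simp
    -- The distance has derivative -1 along the normal, so it falls below r immediately after
    -- leaving Γ.
    have hd : HasDerivAt (fun s : ℝ => hyperplaneDist e (p + s • equidistantNormal e p)) (-1) 0 := by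
      rw [← fderiv_hyperplaneDist_equidistantNormal he hp]
      exact (hasFDerivAt_hyperplaneDist e hp).differentiableAt.hasFDerivAt.comp_hasDerivAt_of_eq
        (0 : ℝ) hline hp0.symm
    have hball : ∀ᶠ s in 𝓝[>] (0 : ℝ), p + s • equidistantNormal e p ∈ ball n := by
      refine (hline.continuousAt.eventually_mem ?_).filter_mono nhdsWithin_le_nhds
      rw [hp0]
      exact isOpen_ball.mem_nhds hp
    have hslope := (hasDerivAt_iff_tendsto_slope.1 hd).mono_left
      (nhdsWithin_mono (0 : ℝ) (fun s (hs : 0 < s) => hs.ne'))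
    filter_upwards [hball, hslope.eventually_lt_const (show (-1 : ℝ) < 0 by norm_num),
      self_mem_nhdsWithin] with s hs hs' hs0
    refine ⟨hs, ?_⟩
    rw [slope_def_field, hp0, hpr, sub_zero, div_lt_iff₀ hs0, zero_mul, sub_neg] at hs'
    exact hs'

/-! ### Boundary values -/

theorem tendsto_hyperplaneDist_nhdsWithin {e : EuclideanSpace ℝ (Fin n)} {r : ℝ}
    {p : EuclideanSpace ℝ (Fin n)} (hp : p ∈ ball n) (hpr : hyperplaneDist e p = r) :
    Tendsto (hyperplaneDist e) (𝓝[outerSide e r] p) (𝓝[>] r) := by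
  refine tendsto_nhdsWithin_iff.2 ⟨?_, ?_⟩
  · rw [← hpr]
    exact ((contDiffOn_hyperplaneDist e).continuousOn.continuousAt
      (isOpen_ball.mem_nhds hp)).tendsto.mono_left nhdsWithin_le_nhds
  · filter_upwards [self_mem_nhdsWithin] with x hx using hx.2

/-- The points at infinity of `hyperplane e` are points at infinity of its equidistants. -/
theorem mem_closure_equidistant {e ξ : EuclideanSpace ℝ (Fin n)} (he : ‖e‖ = 1) {r : ℝ}
    (hr : 0 < r) (hξ : ‖ξ‖ = 1) (hξe : inner ℝ ξ e = 0) : ξ ∈ closure (equidistant e r) := by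
  rw [equidistant_eq he hr]
  have hmem : ∀ s ∈ Ioo (0 : ℝ) 1, s • ξ ∈ hyperplane e := fun s hs => by
    refine ⟨?_, by rw [real_inner_smul_left, hξe, mul_zero]⟩
    change ‖s • ξ‖ < 1
    rw [norm_smul, hξ, mul_one, Real.norm_of_nonneg hs.1.le]
    exact hs.2
  obtain ⟨t, ht⟩ : ∃ t, t = Real.tanh (r / 2) := ⟨_, rfl⟩
  have h1 : Continuous fun s : ℝ => (1 + s ^ 2 * t ^ 2)⁻¹ := by
    refine Continuous.inv₀ (by fun_prop) fun s => by positivity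
  -- The point of the equidistant whose foot is s • ξ; as s tends to 1 its e-component vanishes and
  -- it converges to ξ.
  have h2 : Continuous fun s : ℝ => (1 + s ^ 2 * t ^ 2)⁻¹ •
      ((1 + t ^ 2) • (s • ξ) + ((1 - s ^ 2) * t) • e) := h1.smul (by fun_prop)
  have h3 := h2.tendsto 1
  have h4 : (1 + (1 : ℝ) ^ 2 * t ^ 2)⁻¹ • ((1 + t ^ 2) • ((1 : ℝ) • ξ) +
      ((1 - (1 : ℝ) ^ 2) * t) • e) = ξ := by
    have : 1 + t ^ 2 ≠ 0 := by positivity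
    simp [smul_smul, inv_mul_cancel₀ this]
  rw [h4] at h3
  refine mem_closure_of_tendsto (h3.mono_left (nhdsWithin_le_nhds (s := Iio 1))) ?_
  filter_upwards [Ioo_mem_nhdsLT (zero_lt_one' ℝ)] with s hs
  have h5 := hypTranslation_of_inner_eq_zero he (hmem s hs).2 t
  rw [norm_smul, hξ, mul_one, Real.norm_eq_abs, sq_abs] at h5
  rw [← h5, ht]
  exact ⟨hypTranslation_mem_ball he (hmem s hs) r, hyperplaneDist_hypTranslation he (hmem s hs) r⟩

/-- Off the closure of Γ the limit of ⟨x, e⟩ is strictly positive, since ideal points with ⟨ξ, e⟩ =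
0 lie in that closure. Meanwhile 1 - |x|² tends to 0 from above, so sinh d tends to +∞. -/
theorem tendsto_hyperplaneDist_atTop {e ξ : EuclideanSpace ℝ (Fin n)} (he : ‖e‖ = 1) {r : ℝ}
    (hr : 0 < r) (hξ : ‖ξ‖ = 1) (hΩ : ξ ∈ closure (outerSide e r))
    (hΓ : ξ ∉ closure (equidistant e r)) :
    Tendsto (hyperplaneDist e) (𝓝[outerSide e r] ξ) atTop := by
  have hin : Continuous fun x : EuclideanSpace ℝ (Fin n) => inner ℝ x e := by fun_prop
  have h0 : 0 ≤ inner ℝ ξ e := by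
    refine closure_minimal (t := {x | 0 ≤ inner ℝ x e}) (fun x hx => ?_)
      (isClosed_le continuous_const hin) hΩ
    exact ((hyperplaneDist_pos_iff hx.1).1 (hr.trans hx.2)).le
  have hpos : 0 < inner ℝ ξ e :=
    lt_of_le_of_ne h0 fun h => hΓ (mem_closure_equidistant he hr hξ h.symm)
  have hnum : Tendsto (fun x : EuclideanSpace ℝ (Fin n) => 2 * inner ℝ x e) (𝓝[outerSide e r] ξ)
      (𝓝 (2 * inner ℝ ξ e)) :=
    ((hin.const_mul 2).tendsto ξ).mono_left nhdsWithin_le_nhds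
  have hden : Tendsto (fun x : EuclideanSpace ℝ (Fin n) => 1 - ‖x‖ ^ 2) (𝓝[outerSide e r] ξ)
      (𝓝[>] 0) := by
    refine tendsto_nhdsWithin_iff.2 ⟨?_, ?_⟩
    · have hc : Continuous fun x : EuclideanSpace ℝ (Fin n) => 1 - ‖x‖ ^ 2 := by fun_prop
      have := hc.tendsto ξ
      rw [hξ, one_pow, sub_self] at this
      exact this.mono_left nhdsWithin_le_nhds
    · filter_upwards [self_mem_nhdsWithin] with x hx using one_sub_norm_sq_pos hx.1
  have hsinh : Tendsto (sinhDist e) (𝓝[outerSide e r] ξ) atTop :=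
    (hnum.pos_mul_atTop (by positivity) (tendsto_inv_nhdsGT_zero.comp hden)).congr
      fun x => (div_eq_mul_inv _ _).symm
  exact (Real.sinhOrderIso.symm.tendsto_atTop.comp hsinh :)

end HypProd

/-! ### Choice of r and assembly of the theorem -/

theorem mainTheorem6 (n : ℕ) (hn : 2 ≤ n) (H : ℝ) (hH0 : 0 < H)
    (hH1 : H < ((n : ℝ) - 1) / (n : ℝ))
    (e : EuclideanSpace ℝ (Fin n)) (he : ‖e‖ = 1) :
    ∃ (r : ℝ) (μ : ℝ → ℝ) (Γ Ω : Set (EuclideanSpace ℝ (Fin n)))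
      (ν : EuclideanSpace ℝ (Fin n) → EuclideanSpace ℝ (Fin n))
      (T : Set (EuclideanSpace ℝ (Fin n) × ℝ))
      (N : EuclideanSpace ℝ (Fin n) × ℝ → EuclideanSpace ℝ (Fin n) × ℝ)
      (u : EuclideanSpace ℝ (Fin n) → ℝ),
      -- the equidistant hypersurface and its non-mean-convex side
      0 < r ∧ Γ = HypProd.equidistant e r ∧
      HypProd.HasConstMeanCurvature (HypProd.hypMetric n) Γ ν ((n : ℝ) * H / ((n : ℝ) - 1)) ∧
      HypProd.IsSideOppositeTo Γ ν Ω ∧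
      -- the translation hypersurface, generated by an increasing curve
      ContDiffOn ℝ ∞ μ (Ioi r) ∧ StrictMonoOn μ (Ioi r) ∧
      T = HypProd.translationHypersurface e (Ioi r) μ ∧
      -- it is complete, with mean curvature `H` with respect to the upward unit normal
      HypProd.IsRiemannianComplete (HypProd.prodMetric n) T ∧
      HypProd.HasConstMeanCurvature (HypProd.prodMetric n) T N H ∧
      (∀ q ∈ T, 0 < (N q).2) ∧
      -- it is a vertical graph, with infinite boundary values and infinite asymptotic values
      HypProd.IsVerticalGraph T Ω u ∧
      (∀ p ∈ Γ, Tendsto u (𝓝[Ω] p) atBot) ∧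
      (∀ ξ, ‖ξ‖ = 1 → ξ ∈ closure Ω → ξ ∉ closure Γ → Tendsto u (𝓝[Ω] ξ) atTop) := by
  open HypProd in
  obtain ⟨k, hk, rfl⟩ : ∃ k, 0 < k ∧ n = k + 1 := ⟨n - 1, by omega, by omega⟩
  have hk0 : (0 : ℝ) < k := by exact_mod_cast hk
  have hcast : ((k + 1 : ℕ) : ℝ) - 1 = k := by push_cast; ring
  rw [hcast] at hH1 ⊢
  have hκ0 : 0 < ((k + 1 : ℕ) : ℝ) * H / k := by positivity
  have hκ1 : ((k + 1 : ℕ) : ℝ) * H / k < 1 := by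
    rw [lt_div_iff₀ (by positivity)] at hH1
    rw [div_lt_one hk0]
    linarith
  -- This is where H < (n-1)/n enters: it says that nH/(n-1) is in the range of tanh.
  obtain ⟨r, hrκ⟩ : ∃ r, Real.tanh r = ((k + 1 : ℕ) : ℝ) * H / k :=
    ⟨_, Real.tanh_artanh ⟨by linarith, hκ1⟩⟩
  have hr : 0 < r := by
    rw [← strictMono_tanh.lt_iff_lt, Real.tanh_zero, hrκ]
    exact hκ0
  have hH : (k : ℝ) * Real.tanh r / ((k + 1 : ℕ) : ℝ) = H := by
    rw [hrκ]
    push_cast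
    field_simp
  have hbot : ∀ p ∈ ball (k + 1), hyperplaneDist e p = r →
      Tendsto (fun x => height k r (hyperplaneDist e x)) (𝓝[outerSide e r] p) atBot :=
    fun p hp hpr => (tendsto_height_atBot hk hr).comp (tendsto_hyperplaneDist_nhdsWithin hp hpr)
  have hu := contDiffOn_height_hyperplaneDist hk hr e
  refine ⟨r, height k r, equidistant e r, outerSide e r, equidistantNormal e, _,
    graphNormal k r e, fun x => height k r (hyperplaneDist e x), hr, rfl, ?_,
    isSideOppositeTo_outerSide he hr, contDiffOn_height hk hr, strictMonoOn_height hk hr, rfl, ?_⟩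
  · rw [← hrκ]
    exact hasConstMeanCurvature_equidistant hn he hr
  rw [translationHypersurface_eq he]
  refine ⟨?_, ?_, ?_, ⟨hu, rfl⟩, ?_, ?_⟩
  -- A point of the ball in the closure of {d > r} but not in this set satisfies d = r, so the
  -- divergence of u at Γ covers it.
  · refine isRiemannianComplete_graph (isOpen_outerSide e r) (fun x hx => hx.1) hu
      fun y hy hyb hyΩ => hbot y hyb (le_antisymm (not_lt.1 fun h => hyΩ ⟨hyb, h⟩) ?_)
    have := mem_closure_iff_nhdsWithin_neBot.1 hy
    refine ge_of_tendsto (x := 𝓝[outerSide e r] y) (((contDiffOn_hyperplaneDist e).continuousOn.continuousAt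
      (isOpen_ball.mem_nhds hyb)).tendsto.mono_left nhdsWithin_le_nhds) ?_
    filter_upwards [self_mem_nhdsWithin] with x (hx : x ∈ outerSide e r) using hx.2.le
  · have := hasConstMeanCurvature_graph hk rfl hr he
    rwa [hH] at this
  · exact fun q hq => Real.sqrt_pos.2 (one_sub_profile_sq_pos hk hr hq.1.2)
  · rw [equidistant_eq he hr]
    exact fun p hp => hbot p hp.1 hp.2
  · exact fun ξ hξ hΩ hΓ => (tendsto_height_atTop hk hr).comp
      (tendsto_hyperplaneDist_atTop he hr hξ hΩ hΓ)

end
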